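/- For $k\in\mathbb R\setminus\{0,1\}$ let $\varphi_k(x)=\dfrac{x^k-kx+k-1}{k(k-1)}$ for $x>0$, let $\varphi_k(0)=\lim_{x\downarrow 0}\varphi_k(x)\in[0,\infty]$, and let $\varphi_k(x)=+\infty$ for $x<0$ (the Cressie–Read divergence functions). Fix $\tau>0$ and $B>0$. For a probability measure $P$ on a measurable space $(\Omega,\mathcal F)$ and a measurable $X:\Omega\to[-B,B]$ put $$\mathcal R^P(X)=\sup\Big\{\int X\zeta\,dP:\ \zeta\ge 0 \text{ measurable},\ \int\zeta\,dP=1,\ \int\varphi_k(\zeta)\,dP\le\tau\Big\},$$ and let $\mathcal R_n(X)=\mathcal R^{P_n}(X)$ be its sample average approximation (SAA), where $P_n=\frac1n\sum_{i=1}^n\delta_{\omega_i}$ is the empirical distribution of independent samples $\omega_1,\dots,\omega_n$ from $P$. (1) Let $k>1$. (Upper bound.) There are a constant $C>0$ and an integer $m\ge 0$, depending only on $k,\tau,B$, such that for every measurable space $\Omega$, every probability measure $P$ on it, every measurable $X:\Omega\to[-B,B]$, all $\varepsilon\in(0,B]$ and $\delta\in(0,1)$, and every $$n\ \ge\ C\,\varepsilon^{-\max\{2,\,k/(k-1)\}}\,\big(1+\log(B/\varepsilon)\big)^m\,\big(1+\log(1/\delta)\big),$$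 one has $|\mathcal R^P(X)-\mathcal R_n(X)|\le\varepsilon$ with $P^{\otimes n}$-probability at least $1-\delta$. That is, SAA needs $\tilde{\mathcal O}(\varepsilon^{-\max\{2,k/(k-1)\}})$ samples, uniformly in $P$. (Optimality.) There are constants $c,\varepsilon_0>0$, depending only on $k,\tau,B$, and a function $X:\Omega\to[-B,B]$ on a two-point space $\Omega$ such that for every $\varepsilon\in(0,\varepsilon_0)$, every integer $0\le n\le c\,\varepsilon^{-\max\{2,\,k/(k-1)\}}$ and every estimator (measurable function) $T:\Omega^n\to\mathbb R$ there is a probability measure $P$ on $\Omega$ with $P^{\otimes n}\big(|T-\mathcal R^P(X)|\ge\varepsilon\big)\ge\frac14$. (2) Let $k<1$, $k\ne0$. There are $\varepsilon_0>0$, depending only on $k,\tau,B$, and a function $X:\Omega\to[-B,B]$ on a two-point space $\Omega$ such that for every $\varepsilon\in(0,\varepsilon_0]$, every number of samples $n\ge 0$ and every estimator $T:\Omega^n\to\mathbb R$ there is a probability measure $P$ on $\Omega$ with $P^{\otimes n}\big(|T-\mathcal R^P(X)|\ge\varepsilon\big)\ge\frac14$. That is, no number of samples suffices uniformly in $P$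 to estimate $\mathcal R^P(X)$ to accuracy $\varepsilon$. -/

import Mathlib

open MeasureTheory
open scoped ENNReal

/-- The Cressie–Read divergence function
`φ_k(x) = (x^k - k x + k - 1) / (k (k - 1))` on `[0, ∞)`, extended by `+∞` to `x < 0`.
For `k < 0` one has `x^k → +∞` as `x ↓ 0`, so the (lower semicontinuous) value at `0` is `+∞`.
On the remaining domain the real formula is nonnegative
(see `cressieRead_formula_nonneg`), so `ENNReal.ofReal` does not truncate. -/
noncomputable def cressieRead (k x : ℝ) : ℝ≥0∞ :=
  if x < 0 ∨ (x = 0 ∧ k < 0) then ∞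
  else ENNReal.ofReal ((x ^ k - k * x + k - 1) / (k * (k - 1)))

theorem cressieRead_formula_nonneg {k x : ℝ} (hx : 0 ≤ x) (hxk : x ≠ 0 ∨ 0 ≤ k) :
    0 ≤ (x ^ k - k * x + k - 1) / (k * (k - 1)) := by
  have h1 : x ^ k = (1 + (x - 1)) ^ k := by congr 1; ring
  have hs : -1 ≤ x - 1 := by linarith
  rcases lt_or_ge k 0 with hk | hk
  · have hx' : 0 < x := lt_of_le_of_ne hx (Ne.symm (hxk.resolve_right (not_le.mpr hk)))
    have h2 := Real.add_one_le_exp (Real.log x * k)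
    rw [← Real.rpow_def_of_pos hx'] at h2
    have h3 := Real.log_le_sub_one_of_pos hx'
    exact div_nonneg (by nlinarith) (by nlinarith)
  rcases le_or_gt k 1 with hk' | hk'
  · have h2 := rpow_one_add_le_one_add_mul_self hs hk hk'
    rw [← h1] at h2
    exact div_nonneg_of_nonpos (by nlinarith) (by nlinarith)
  · have h2 := one_add_mul_self_le_rpow_one_add hs hk'.le
    rw [← h1] at h2
    exact div_nonneg (by nlinarith) (by nlinarith)

/-- Probability densities with respect to `P`. -/
def IsDensity {Ω : Type*} [MeasurableSpace Ω] (P : Measure Ω) (ζ : Ω → ℝ) : Prop :=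
  Measurable ζ ∧ (∀ ω, 0 ≤ ζ ω) ∧ ∫⁻ ω, ENNReal.ofReal (ζ ω) ∂P = 1

/-- The ambiguity set `𝔐_τ(P)`: the densities `ζ` with `∫ φ(ζ) dP ≤ τ`. -/
def ambiguitySet {Ω : Type*} [MeasurableSpace Ω] (φ : ℝ → ℝ≥0∞) (τ : ℝ) (P : Measure Ω) :
    Set (Ω → ℝ) :=
  {ζ | IsDensity P ζ ∧ ∫⁻ ω, φ (ζ ω) ∂P ≤ ENNReal.ofReal τ}

/-- The distributionally robust functional
`R(X) = sup { ∫ X ζ dP : ζ ∈ 𝔐_τ(P) }`. -/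
noncomputable def robustValue {Ω : Type*} [MeasurableSpace Ω] (φ : ℝ → ℝ≥0∞) (τ : ℝ)
    (P : Measure Ω) (X : Ω → ℝ) : ℝ :=
  sSup ((fun ζ : Ω → ℝ => ∫ ω, X ω * ζ ω ∂P) '' ambiguitySet φ τ P)

/-- The empirical distribution `P_n = (1/n) ∑ᵢ δ_{ωᵢ}` of a sample `ω₁, …, ω_n`. -/
noncomputable def empiricalMeasure {Ω : Type*} [MeasurableSpace Ω] {n : ℕ} (ω : Fin n → Ω) :
    Measure Ω :=
  (n : ℝ≥0∞)⁻¹ • ∑ i, Measure.dirac (ω i)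

/-- The sample average approximation `R_n(X)`: the functional `R(X)` with the
empirical distribution in place of `P`. -/
noncomputable def saaValue {Ω : Type*} [MeasurableSpace Ω] (φ : ℝ → ℝ≥0∞) (τ : ℝ)
    (X : Ω → ℝ) {n : ℕ} (ω : Fin n → Ω) : ℝ :=
  robustValue φ τ (empiricalMeasure ω) X

/-- The law `P^{⊗n}` of `n` independent samples from `P`. -/
noncomputable def sampleLaw {Ω : Type*} [MeasurableSpace Ω] (P : Measure Ω) (n : ℕ) :
    Measure (Fin n → Ω) :=
  Measure.pi fun _ => P

/-! Let k > 1, q = k/(k-1), K = 1 + k(k-1)τ and A = K^(1/k). Since densities integrate to one, the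
divergence constraint is just ∫ζ^k ≤ K (`mem_ambiguitySet_iff`). Hölder's inequality and its
equality case then give R(X) = min over t of t + A‖(X-t)₊‖_q, with t in an interval independent of
the measure (`robustValue_le_dualValue`, `exists_dualValue_le_robustValue`). Estimating R reduces to
estimating q-norms uniformly in t.

A variable in [0,1] with mean r^q has variance at most r^q, and accuracy ε in r requires accuracy
about ε r^(q-1) in the mean. That takes about ε^(-2) r^(2-q) samples for r ≥ ε; the worst case is r
= 1 if q ≤ 2 and r = ε if q ≥ 2, hence the exponent max{2,q} (`sampleLaw_norm_concentration`). A
grid in t costs one logarithm.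

The lower bounds compare two Bernoulli laws (`le_cam`). An atom of mass p of order ε^q at B can be
reweighted to mass of order ε, but is unseen in about 1/p samples; this gives exponent q. Shifting a
fixed Bernoulli parameter by order ε gives exponent 2. For k < 1, φ_k grows only linearly, so an
arbitrarily rare atom can receive a fixed mass at bounded cost: R jumps when the atom disappears,
and no sample size detects this. -/

/-! ### Densities and the moment form of the ambiguity set -/

theorem isDensity_iff {Ω : Type*} [MeasurableSpace Ω] {P : Measure Ω} {ζ : Ω → ℝ} :
    IsDensity P ζ ↔ Measurable ζ ∧ (∀ ω, 0 ≤ ζ ω) ∧ Integrable ζ P ∧ ∫ ω, ζ ω ∂P = 1 := by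
  refine ⟨fun ⟨hm, h0, h1⟩ => ?_, fun ⟨hm, h0, hi, h1⟩ => ⟨hm, h0, ?_⟩⟩
  · refine ⟨hm, h0, ⟨hm.aestronglyMeasurable, ?_⟩, ?_⟩
    · rw [hasFiniteIntegral_iff_ofReal (Filter.Eventually.of_forall h0), h1]
      exact ENNReal.one_lt_top
    · rw [integral_eq_lintegral_of_nonneg_ae (Filter.Eventually.of_forall h0)
        hm.aestronglyMeasurable, h1, ENNReal.toReal_one]
  · rw [← ofReal_integral_eq_lintegral_ofReal hi (Filter.Eventually.of_forall h0), h1,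
      ENNReal.ofReal_one]

theorem cressieRead_of_nonneg {k x : ℝ} (hx : 0 ≤ x) (hxk : x ≠ 0 ∨ 0 ≤ k) :
    cressieRead k x = ENNReal.ofReal ((x ^ k - k * x + k - 1) / (k * (k - 1))) := by
  rw [cressieRead, if_neg]
  rintro (h | ⟨h, h'⟩)
  · exact absurd h hx.not_gt
  · rcases hxk with h2 | h2
    · exact h2 h
    · exact h2.not_gt h'

/-- This integrates k(k-1)φ_k(ζ) = ζ^k - kζ + k - 1. Terms are placed so that nothing is subtracted
in `ℝ≥0∞`, which keeps the identity valid when the moment is infinite. -/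
theorem lintegral_rpow_add_eq {k : ℝ} (hk : 1 < k) {Ω : Type*} [MeasurableSpace Ω]
    {P : Measure Ω} [IsProbabilityMeasure P] {ζ : Ω → ℝ} (hζ : IsDensity P ζ) :
    ∫⁻ ω, ENNReal.ofReal (ζ ω ^ k) ∂P + ENNReal.ofReal (k - 1) =
      ENNReal.ofReal (k * (k - 1)) * ∫⁻ ω, cressieRead k (ζ ω) ∂P + ENNReal.ofReal k := by
  obtain ⟨hm, h0, h1⟩ := hζ
  have hκ : 0 < k * (k - 1) := mul_pos (by linarith) (by linarith)
  have hpt : ∀ ω, ENNReal.ofReal (ζ ω ^ k) + ENNReal.ofReal (k - 1) =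
      ENNReal.ofReal (k * (k - 1)) * cressieRead k (ζ ω)
        + ENNReal.ofReal k * ENNReal.ofReal (ζ ω) := fun ω => by
    rw [cressieRead_of_nonneg (h0 ω) (Or.inr (by linarith)), ← ENNReal.ofReal_mul hκ.le,
      ← ENNReal.ofReal_mul (by linarith), ← ENNReal.ofReal_add (Real.rpow_nonneg (h0 ω) k)
      (by linarith), ← ENNReal.ofReal_add _ (mul_nonneg (by linarith) (h0 ω)),
      mul_div_cancel₀ _ hκ.ne']
    · congr 1; ring
    · exact mul_nonneg hκ.le (cressieRead_formula_nonneg (h0 ω) (Or.inr (by linarith)))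
  have hζ' : Measurable fun ω => ENNReal.ofReal k * ENNReal.ofReal (ζ ω) :=
    hm.ennreal_ofReal.const_mul _
  have h := lintegral_congr (μ := P) hpt
  rw [lintegral_add_right _ measurable_const, lintegral_add_right _ hζ',
    lintegral_const_mul' _ _ ENNReal.ofReal_ne_top, lintegral_const_mul' _ _ ENNReal.ofReal_ne_top,
    h1] at h
  simpa using h

theorem mem_ambiguitySet_iff {k τ : ℝ} (hk : 1 < k) (hτ : 0 < τ) {Ω : Type*} [MeasurableSpace Ω]
    {P : Measure Ω} [IsProbabilityMeasure P] {ζ : Ω → ℝ} :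
    ζ ∈ ambiguitySet (cressieRead k) τ P ↔ IsDensity P ζ ∧
      Integrable (fun ω => ζ ω ^ k) P ∧ ∫ ω, ζ ω ^ k ∂P ≤ 1 + k * (k - 1) * τ := by
  refine and_congr_right fun hζ => ?_
  have hκ : 0 < k * (k - 1) := mul_pos (by linarith) (by linarith)
  have hA : 0 ≤ 1 + k * (k - 1) * τ := by positivity
  have hpow : ∀ ω, 0 ≤ ζ ω ^ k := fun ω => Real.rpow_nonneg (hζ.2.1 ω) k
  have hmeas : Measurable fun ω => ζ ω ^ k := hζ.1.pow_const k
  have h1 := lintegral_rpow_add_eq hk hζ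
  have h2 : ENNReal.ofReal (1 + k * (k - 1) * τ) + ENNReal.ofReal (k - 1) =
      ENNReal.ofReal (k * (k - 1)) * ENNReal.ofReal τ + ENNReal.ofReal k := by
    rw [← ENNReal.ofReal_mul hκ.le, ← ENNReal.ofReal_add hA (by linarith),
      ← ENNReal.ofReal_add (by positivity) (by linarith)]
    congr 1; ring
  have h3 : ∫⁻ ω, cressieRead k (ζ ω) ∂P ≤ ENNReal.ofReal τ ↔
      ∫⁻ ω, ENNReal.ofReal (ζ ω ^ k) ∂P ≤ ENNReal.ofReal (1 + k * (k - 1) * τ) := by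
    refine Iff.symm ?_
    rw [← ENNReal.add_le_add_iff_right (a := ENNReal.ofReal (k - 1)) ENNReal.ofReal_ne_top, h1, h2,
      ENNReal.add_le_add_iff_right ENNReal.ofReal_ne_top,
      ENNReal.mul_le_mul_iff_right (by simpa using hκ) ENNReal.ofReal_ne_top]
  rw [h3]
  constructor
  · intro h
    have hi : Integrable (fun ω => ζ ω ^ k) P := by
      refine ⟨hmeas.aestronglyMeasurable, ?_⟩
      rw [hasFiniteIntegral_iff_ofReal (Filter.Eventually.of_forall hpow)]
      exact h.trans_lt ENNReal.ofReal_lt_top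
    refine ⟨hi, ?_⟩
    rw [← ofReal_integral_eq_lintegral_ofReal hi (Filter.Eventually.of_forall hpow)] at h
    exact (ENNReal.ofReal_le_ofReal_iff hA).1 h
  · rintro ⟨hi, h⟩
    rw [← ofReal_integral_eq_lintegral_ofReal hi (Filter.Eventually.of_forall hpow)]
    exact ENNReal.ofReal_le_ofReal h

/-- Since φ_k(1) = 0, the supremum is over a nonempty set, as `csSup_le` requires. -/
theorem one_mem_ambiguitySet {k τ : ℝ} {Ω : Type*} [MeasurableSpace Ω]
    {P : Measure Ω} [IsProbabilityMeasure P] :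
    (fun _ => 1) ∈ ambiguitySet (cressieRead k) τ P := by
  refine ⟨⟨measurable_const, fun _ => zero_le_one, by simp⟩, ?_⟩
  simp [cressieRead_of_nonneg zero_le_one (Or.inl one_ne_zero)]

theorem IsDensity.integrable_mul {Ω : Type*} [MeasurableSpace Ω] {P : Measure Ω} {ζ X : Ω → ℝ}
    (hζ : IsDensity P ζ) (hX : Measurable X) {B : ℝ} (hB : ∀ ω, |X ω| ≤ B) :
    Integrable (fun ω => X ω * ζ ω) P :=
  (isDensity_iff.1 hζ).2.2.1.bdd_mul (c := B) hX.aestronglyMeasurable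
    (Filter.Eventually.of_forall fun ω => hB ω)

theorem bddAbove_robustValue {Ω : Type*} [MeasurableSpace Ω] {P : Measure Ω} (φ : ℝ → ℝ≥0∞) (τ : ℝ)
    {X : Ω → ℝ} (hX : Measurable X) {B : ℝ} (hB : ∀ ω, |X ω| ≤ B) :
    BddAbove ((fun ζ : Ω → ℝ => ∫ ω, X ω * ζ ω ∂P) '' ambiguitySet φ τ P) := by
  refine ⟨B, ?_⟩
  rintro _ ⟨ζ, hζ, rfl⟩
  obtain ⟨-, h0, hi, h1⟩ := isDensity_iff.1 hζ.1
  calc ∫ ω, X ω * ζ ω ∂P ≤ ∫ ω, B * ζ ω ∂P :=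
        integral_mono (hζ.1.integrable_mul hX hB) (hi.const_mul B) fun ω =>
          mul_le_mul_of_nonneg_right (abs_le.1 (hB ω)).2 (h0 ω)
    _ = B := by rw [integral_const_mul, h1, mul_one]

theorem integral_le_robustValue {Ω : Type*} [MeasurableSpace Ω] {P : Measure Ω} {φ : ℝ → ℝ≥0∞}
    {τ : ℝ} {X ζ : Ω → ℝ} (hX : Measurable X) {B : ℝ} (hB : ∀ ω, |X ω| ≤ B)
    (hζ : ζ ∈ ambiguitySet φ τ P) : ∫ ω, X ω * ζ ω ∂P ≤ robustValue φ τ P X :=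
  le_csSup (bddAbove_robustValue φ τ hX hB) ⟨ζ, hζ, rfl⟩

/-! ### Hinge moments and weak duality -/

theorem hinge_le {Ω : Type*} {X : Ω → ℝ} {B : ℝ} (hB : ∀ ω, |X ω| ≤ B) {L t : ℝ} (hL : 0 ≤ B + L)
    (ht : -L ≤ t) (ω : Ω) : max (X ω - t) 0 ≤ B + L :=
  max_le (by linarith [(abs_le.1 (hB ω)).2]) hL

/-- The moment `∫ (X - t)₊ ^ s dP`. -/
noncomputable def hingeMoment {Ω : Type*} [MeasurableSpace Ω] (P : Measure Ω) (X : Ω → ℝ)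
    (s t : ℝ) : ℝ :=
  ∫ ω, max (X ω - t) 0 ^ s ∂P

/-- The dual objective `t + A ‖(X - t)₊‖_q`. -/
noncomputable def dualValue {Ω : Type*} [MeasurableSpace Ω] (A q : ℝ) (P : Measure Ω) (X : Ω → ℝ)
    (t : ℝ) : ℝ :=
  t + A * hingeMoment P X q t ^ (1 / q)

section
variable {Ω : Type*} [MeasurableSpace Ω] {P : Measure Ω} {X : Ω → ℝ} {B : ℝ}

theorem hingeMoment_nonneg (s t : ℝ) : 0 ≤ hingeMoment P X s t :=
  integral_nonneg fun _ => Real.rpow_nonneg (le_max_right _ _) _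

theorem memLp_hinge [IsProbabilityMeasure P] (hX : Measurable X) (hB : ∀ ω, |X ω| ≤ B) (p : ℝ≥0∞)
    (t : ℝ) : MemLp (fun ω => max (X ω - t) 0) p P := by
  refine MemLp.of_bound ((hX.sub_const t).max measurable_const).aestronglyMeasurable (B + |t|)
    (Filter.Eventually.of_forall fun ω => ?_)
  have h1 := abs_le.1 (hB ω)
  have h2 := neg_abs_le t
  rw [Real.norm_of_nonneg (le_max_right _ _)]
  exact max_le (by linarith) (by linarith [abs_nonneg (X ω), hB ω, abs_nonneg t])

theorem integrable_hinge_rpow [IsProbabilityMeasure P] (hX : Measurable X) (hB : ∀ ω, |X ω| ≤ B)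
    {s : ℝ} (hs : 0 ≤ s) (t : ℝ) : Integrable (fun ω => max (X ω - t) 0 ^ s) P := by
  refine Integrable.of_bound (((hX.sub_const t).max measurable_const).pow_const s).aestronglyMeasurable
    ((B + |t|) ^ s) (Filter.Eventually.of_forall fun ω => ?_)
  have h1 := abs_le.1 (hB ω)
  have h2 := neg_abs_le t
  rw [Real.norm_of_nonneg (Real.rpow_nonneg (le_max_right _ _) _)]
  exact Real.rpow_le_rpow (le_max_right _ _) (max_le (by linarith)
    (by linarith [abs_nonneg (X ω), hB ω, abs_nonneg t])) hs

theorem hingeMoment_antitone [IsProbabilityMeasure P] (hX : Measurable X) (hB : ∀ ω, |X ω| ≤ B)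
    {s : ℝ} (hs : 0 ≤ s) : Antitone (hingeMoment P X s) := fun a b hab =>
  integral_mono (integrable_hinge_rpow hX hB hs b) (integrable_hinge_rpow hX hB hs a) fun _ =>
    Real.rpow_le_rpow (le_max_right _ _) (max_le_max (by linarith) le_rfl) hs

theorem continuous_hingeMoment [IsProbabilityMeasure P] (hX : Measurable X)
    (hB : ∀ ω, |X ω| ≤ B) {s : ℝ} (hs : 0 ≤ s) : Continuous (hingeMoment P X s) := by
  rw [continuous_iff_continuousAt]
  intro t
  have hmeas : ∀ u, Measurable fun ω => max (X ω - u) 0 ^ s := fun u =>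
    ((hX.sub_const u).max measurable_const).pow_const s
  refine continuousAt_of_dominated (bound := fun ω => max (X ω - (t - 1)) 0 ^ s)
    (Filter.Eventually.of_forall fun u => (hmeas u).aestronglyMeasurable) ?_
    (integrable_hinge_rpow hX hB hs _) (Filter.Eventually.of_forall fun ω => ?_)
  · filter_upwards [lt_mem_nhds (show t - 1 < t by linarith)] with u hu
    refine Filter.Eventually.of_forall fun ω => ?_
    rw [Real.norm_of_nonneg (Real.rpow_nonneg (le_max_right _ _) _)]
    exact Real.rpow_le_rpow (le_max_right _ _) (max_le_max (by linarith) le_rfl) hs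
  · exact (((continuous_const.sub continuous_id).max continuous_const).rpow_const
      fun _ => Or.inr hs).continuousAt

theorem hingeMoment_self_eq_zero (hB : ∀ ω, |X ω| ≤ B) {s : ℝ} (hs : 0 < s) :
    hingeMoment P X s B = 0 := by
  have : ∀ ω, max (X ω - B) 0 = 0 := fun ω =>
    max_eq_right (by linarith [(abs_le.1 (hB ω)).2])
  simp [hingeMoment, this, Real.zero_rpow hs.ne']

/-- Integrate Xζ ≤ tζ + ζ(X-t)₊ and apply Hölder to the last product. -/
theorem IsDensity.integral_mul_le {k q : ℝ} (hkq : k.HolderConjugate q) [IsProbabilityMeasure P]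
    (hX : Measurable X) (hB : ∀ ω, |X ω| ≤ B) {ζ : Ω → ℝ} (hζ : IsDensity P ζ)
    (hi : Integrable (fun ω => ζ ω ^ k) P) (t : ℝ) :
    ∫ ω, X ω * ζ ω ∂P ≤
      t + (∫ ω, ζ ω ^ k ∂P) ^ (1 / k) * hingeMoment P X q t ^ (1 / q) := by
  obtain ⟨hm, h0, hζi, h1⟩ := isDensity_iff.1 hζ
  have hmem : MemLp ζ (ENNReal.ofReal k) P := by
    rw [← integrable_norm_rpow_iff hm.aestronglyMeasurable (by simpa using hkq.pos)
      ENNReal.ofReal_ne_top, ENNReal.toReal_ofReal hkq.nonneg]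
    simpa only [Real.norm_of_nonneg (h0 _)] using hi
  have hH := integral_mul_le_Lp_mul_Lq_of_nonneg hkq (Filter.Eventually.of_forall h0)
    (Filter.Eventually.of_forall fun ω => le_max_right (X ω - t) 0) hmem (memLp_hinge hX hB _ t)
  have hmi : Integrable (fun ω => ζ ω * max (X ω - t) 0) P := by
    have := (memLp_hinge (P := P) hX hB ∞ t)
    exact hζi.mul_of_top_left this
  calc ∫ ω, X ω * ζ ω ∂P ≤ ∫ ω, (t * ζ ω + ζ ω * max (X ω - t) 0) ∂P := by
        refine integral_mono (hζ.integrable_mul hX hB) ((hζi.const_mul t).add hmi) fun ω => ?_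
        have := mul_le_mul_of_nonneg_left (le_max_left (X ω - t) 0) (h0 ω)
        simp only
        nlinarith
    _ = t + ∫ ω, ζ ω * max (X ω - t) 0 ∂P := by
        rw [integral_add (hζi.const_mul t) hmi, integral_const_mul, h1, mul_one]
    _ ≤ _ := by simpa [hingeMoment] using hH

/-- Weak duality. -/
theorem robustValue_le_dualValue {k q τ : ℝ} (hkq : k.HolderConjugate q) (hτ : 0 < τ)
    [IsProbabilityMeasure P] (hX : Measurable X) (hB : ∀ ω, |X ω| ≤ B) (t : ℝ) :
    robustValue (cressieRead k) τ P X ≤ dualValue ((1 + k * (k - 1) * τ) ^ (1 / k)) q P X t := by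
  refine csSup_le ⟨_, _, one_mem_ambiguitySet, rfl⟩ ?_
  rintro _ ⟨ζ, hζ, rfl⟩
  obtain ⟨hd, hi, hle⟩ := (mem_ambiguitySet_iff hkq.lt hτ).1 hζ
  refine (hd.integral_mul_le hkq hX hB hi t).trans ?_
  unfold dualValue
  gcongr
  · exact Real.rpow_nonneg (hingeMoment_nonneg _ _) _
  · exact integral_nonneg fun ω => Real.rpow_nonneg (hd.2.1 ω) _
  · exact one_div_nonneg.2 hkq.nonneg

end

/-! ### Strong duality -/

section
variable {Ω : Type*} [MeasurableSpace Ω] {P : Measure Ω} {X : Ω → ℝ} {B : ℝ}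

theorem max_zero_mul_rpow {x s : ℝ} (hs : 0 < s) :
    x * max x 0 ^ s = max x 0 ^ (s + 1) := by
  rcases le_or_gt x 0 with h | h
  · rw [max_eq_right h, Real.zero_rpow hs.ne', Real.zero_rpow (by linarith), mul_zero]
  · rw [max_eq_left h.le, Real.rpow_add_one h.ne', mul_comm]

/-- The equality case of Hölder: ζ = c(X-t)₊^(q-1), with c fixed by ∫ζ^k = K. The hypothesis `hstat`
says that the t-derivative of the dual objective vanishes, and it is exactly what makes ∫ζ = 1. -/
theorem dualValue_le_robustValue_of_stationary {k q τ : ℝ} (hkq : k.HolderConjugate q)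
    (hτ : 0 < τ) [IsProbabilityMeasure P] (hX : Measurable X) (hB : ∀ ω, |X ω| ≤ B) {t : ℝ}
    (hpos : 0 < hingeMoment P X q t)
    (hstat : (1 + k * (k - 1) * τ) ^ (1 / k) * hingeMoment P X (q - 1) t =
      hingeMoment P X q t ^ (1 / k)) :
    dualValue ((1 + k * (k - 1) * τ) ^ (1 / k)) q P X t ≤ robustValue (cressieRead k) τ P X := by
  have hk := hkq.lt
  have hq := hkq.symm.lt
  have hK : 0 < 1 + k * (k - 1) * τ := by
    have : 0 < k * (k - 1) := mul_pos (by linarith) (by linarith)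
    positivity
  set K := 1 + k * (k - 1) * τ with hKdef
  set M := hingeMoment P X q t with hM
  have hMk : 0 < M ^ (1 / k) := Real.rpow_pos_of_pos hpos _
  have hAk : 0 < K ^ (1 / k) := Real.rpow_pos_of_pos hK _
  set c := K ^ (1 / k) / M ^ (1 / k) with hc
  have hc0 : 0 < c := div_pos hAk hMk
  have hck : c ^ k = K / M := by
    rw [hc, Real.div_rpow hAk.le hMk.le, ← Real.rpow_mul hK.le, ← Real.rpow_mul hpos.le,
      one_div_mul_cancel hkq.ne_zero, Real.rpow_one, Real.rpow_one]
  have hi1 := integrable_hinge_rpow (P := P) hX hB (s := q - 1) (by linarith) t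
  have hi2 := integrable_hinge_rpow (P := P) hX hB (s := q) (by linarith) t
  have hh : ∀ ω, 0 ≤ max (X ω - t) 0 := fun ω => le_max_right _ _
  have hζk : ∀ ω, (c * max (X ω - t) 0 ^ (q - 1)) ^ k = K / M * max (X ω - t) 0 ^ q := fun ω => by
    rw [Real.mul_rpow hc0.le (Real.rpow_nonneg (hh ω) _), hck, ← Real.rpow_mul (hh ω),
      hkq.symm.sub_one_mul_conj]
  have hmem : (fun ω => c * max (X ω - t) 0 ^ (q - 1)) ∈ ambiguitySet (cressieRead k) τ P := by
    refine (mem_ambiguitySet_iff hk hτ).2 ⟨isDensity_iff.2 ⟨?_, ?_, hi1.const_mul c, ?_⟩, ?_, ?_⟩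
    · exact (((hX.sub_const t).max measurable_const).pow_const _).const_mul c
    · exact fun ω => mul_nonneg hc0.le (Real.rpow_nonneg (hh ω) _)
    · rw [integral_const_mul, hc, div_mul_eq_mul_div, div_eq_one_iff_eq hMk.ne']
      exact hstat
    · simp_rw [hζk]
      exact hi2.const_mul _
    · simp_rw [hζk]
      rw [integral_const_mul]
      change K / M * M ≤ K
      rw [div_mul_cancel₀ _ hpos.ne']
  refine le_of_eq_of_le ?_ (integral_le_robustValue hX hB hmem)
  have hpt : ∀ ω, X ω * (c * max (X ω - t) 0 ^ (q - 1)) =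
      t * (c * max (X ω - t) 0 ^ (q - 1)) + c * max (X ω - t) 0 ^ q := fun ω => by
    have := max_zero_mul_rpow (x := X ω - t) (s := q - 1) (by linarith)
    rw [sub_add_cancel] at this
    rw [← this]; ring
  have hone : ∫ ω, c * max (X ω - t) 0 ^ (q - 1) ∂P = 1 := (isDensity_iff.1 hmem.1).2.2.2
  simp_rw [hpt]
  rw [integral_add ((hi1.const_mul c).const_mul t) (hi2.const_mul c), integral_const_mul, hone,
    integral_const_mul]
  change t + K ^ (1 / k) * M ^ (1 / q) = t * 1 + c * M
  have hsplit : M = M ^ (1 / q) * M ^ (1 / k) := by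
    rw [← Real.rpow_add hpos, one_div, one_div, hkq.symm.inv_add_inv_eq_one, Real.rpow_one]
  have hcM : c * M = K ^ (1 / k) * M ^ (1 / q) := by
    calc c * M = c * (M ^ (1 / q) * M ^ (1 / k)) := by rw [← hsplit]
      _ = _ := by rw [hc]; field_simp
  rw [hcM, mul_one]

/-- Here the dual objective is nonincreasing at t. Hölder against the indicator of E = {X > t} turns
this into K p^(k-1) ≥ 1 for p = P(E), which is the feasibility of the density p⁻¹ on E; that density
lives where X > t. -/
theorem le_robustValue_of_gradient_nonneg {k q τ : ℝ} (hkq : k.HolderConjugate q)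
    (hτ : 0 < τ) [IsProbabilityMeasure P] (hX : Measurable X) (hB : ∀ ω, |X ω| ≤ B) {t : ℝ}
    (hpos : 0 < hingeMoment P X q t)
    (hgrad : hingeMoment P X q t ^ (1 / k) ≤
      (1 + k * (k - 1) * τ) ^ (1 / k) * hingeMoment P X (q - 1) t) :
    t ≤ robustValue (cressieRead k) τ P X := by
  have hk := hkq.lt
  have hq := hkq.symm.lt
  have hK : 0 < 1 + k * (k - 1) * τ := by
    have : 0 < k * (k - 1) := mul_pos (by linarith) (by linarith)
    positivity
  set K := 1 + k * (k - 1) * τ with hKdef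
  set E : Set Ω := {ω | t < X ω} with hE
  have hEm : MeasurableSet E := measurableSet_lt measurable_const hX
  set p := P.real E with hp
  have hp0 : 0 ≤ p := measureReal_nonneg
  have hh : ∀ ω, 0 ≤ max (X ω - t) 0 := fun ω => le_max_right _ _
  have hind : ∀ (c s : ℝ), 0 < s → (fun ω => E.indicator (fun _ => c) ω ^ s) =
      E.indicator fun _ => c ^ s := fun c s hs => by
    ext ω
    by_cases h : ω ∈ E
    · simp [h]
    · simp [h, Real.zero_rpow hs.ne']
  have hint : ∀ c : ℝ, ∫ ω, E.indicator (fun _ => c) ω ∂P = p * c := fun c => by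
    rw [integral_indicator_const _ hEm, smul_eq_mul]
  have hholder : hingeMoment P X (q - 1) t ≤ p ^ (1 / q) * hingeMoment P X q t ^ (1 / k) := by
    have hmem : MemLp (fun ω => max (X ω - t) 0 ^ (q - 1)) (ENNReal.ofReal k) P := by
      refine (integrable_norm_rpow_iff ?_ ?_ ENNReal.ofReal_ne_top).1 ?_
      · exact (((hX.sub_const t).max measurable_const).pow_const _).aestronglyMeasurable
      · simpa using hkq.pos
      · simp_rw [Real.norm_of_nonneg (Real.rpow_nonneg (hh _) _)]
        rw [ENNReal.toReal_ofReal hkq.nonneg]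
        simp_rw [← Real.rpow_mul (hh _), hkq.symm.sub_one_mul_conj]
        exact integrable_hinge_rpow hX hB (by linarith) t
    have hH := integral_mul_le_Lp_mul_Lq_of_nonneg (μ := P) (f := E.indicator fun _ => (1 : ℝ))
      hkq.symm (Filter.Eventually.of_forall fun ω => Set.indicator_nonneg
        (fun _ _ => zero_le_one) ω) (Filter.Eventually.of_forall fun ω =>
        Real.rpow_nonneg (hh ω) (q - 1)) ((memLp_const _).indicator hEm) hmem
    rw [hind _ _ (by linarith), Real.one_rpow, hint, mul_one] at hH
    simp_rw [← Real.rpow_mul (hh _), hkq.symm.sub_one_mul_conj] at hH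
    refine le_of_eq_of_le (integral_congr_ae (Filter.Eventually.of_forall fun ω => ?_)) hH
    by_cases h : ω ∈ E
    · simp [h]
    · have : max (X ω - t) 0 = 0 := max_eq_right (by simpa [hE] using h)
      simp [h, this, Real.zero_rpow (sub_pos.2 hq).ne']
  have hMk : 0 < hingeMoment P X q t ^ (1 / k) := Real.rpow_pos_of_pos hpos _
  have h1 : 1 ≤ K ^ (1 / k) * p ^ (1 / q) := by
    have := hgrad.trans (mul_le_mul_of_nonneg_left hholder (Real.rpow_nonneg hK.le (1 / k)))
    rw [← mul_assoc] at this
    exact (le_mul_iff_one_le_left hMk).1 this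
  have hp1 : 0 < p := by
    refine hp0.lt_of_ne fun h => ?_
    rw [← h, Real.zero_rpow (one_div_pos.2 (by linarith)).ne', mul_zero] at h1
    linarith
  have h2 : 1 ≤ K * p ^ (k - 1) := by
    have := Real.one_le_rpow h1 hkq.nonneg
    rwa [Real.mul_rpow (Real.rpow_nonneg hK.le _) (Real.rpow_nonneg hp0 _),
      ← Real.rpow_mul hK.le, one_div_mul_cancel hkq.ne_zero, Real.rpow_one, ← Real.rpow_mul hp0,
      one_div_mul_eq_div, hkq.div_conj_eq_sub_one] at this
  have hmem : E.indicator (fun _ => p⁻¹) ∈ ambiguitySet (cressieRead k) τ P := by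
    refine (mem_ambiguitySet_iff hk hτ).2 ⟨isDensity_iff.2 ⟨?_, ?_, ?_, ?_⟩, ?_, ?_⟩
    · exact measurable_const.indicator hEm
    · exact fun ω => Set.indicator_nonneg (fun _ _ => inv_nonneg.2 hp0) ω
    · exact (integrable_const _).indicator hEm
    · rw [hint, mul_inv_cancel₀ hp1.ne']
    · rw [hind _ _ hkq.pos]
      exact (integrable_const _).indicator hEm
    · rw [hind _ _ hkq.pos, hint, Real.inv_rpow hp0]
      rw [Real.rpow_sub_one hp1.ne'] at h2
      have := Real.rpow_pos_of_pos hp1 k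
      rw [← div_eq_mul_inv, div_le_iff₀ this]
      rw [← mul_div_assoc, le_div_iff₀ hp1] at h2
      linarith
  refine le_trans ?_ (integral_le_robustValue hX hB hmem)
  obtain ⟨-, h0, hi, hone⟩ := isDensity_iff.1 hmem.1
  calc t = ∫ ω, t * E.indicator (fun _ => p⁻¹) ω ∂P := by
        rw [integral_const_mul, hone, mul_one]
    _ ≤ _ := by
        refine integral_mono (hi.const_mul t) (hmem.1.integrable_mul hX hB) fun ω => ?_
        by_cases h : ω ∈ E
        · exact mul_le_mul_of_nonneg_right (le_of_lt h) (h0 ω)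
        · simp [h]

/-- Strong duality, with a dual optimizer in a range that does not depend on the measure. -/
theorem exists_dualValue_le_robustValue {k q τ : ℝ} (hkq : k.HolderConjugate q)
    (hτ : 0 < τ) [IsProbabilityMeasure P] (hX : Measurable X) (hB : ∀ ω, |X ω| ≤ B) (hB0 : 0 ≤ B)
    {L : ℝ} (hBL : B < L)
    (hL : L + B ≤ (L - B) * ((1 + k * (k - 1) * τ) ^ (1 / k)) ^ (k - 1)) :
    ∃ t ∈ Set.Icc (-L) B,
      dualValue ((1 + k * (k - 1) * τ) ^ (1 / k)) q P X t ≤ robustValue (cressieRead k) τ P X := by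
  have hk := hkq.lt
  have hq := hkq.symm.lt
  have hK : 0 < 1 + k * (k - 1) * τ := by
    have : 0 < k * (k - 1) := mul_pos (by linarith) (by linarith)
    positivity
  have hA : 0 < (1 + k * (k - 1) * τ) ^ (1 / k) := Real.rpow_pos_of_pos hK _
  set A := (1 + k * (k - 1) * τ) ^ (1 / k) with hAdef
  have hlow : ∀ ω, L - B ≤ max (X ω - -L) 0 := fun ω =>
    le_max_of_le_left (by linarith [(abs_le.1 (hB ω)).1])
  have hupp : ∀ ω, max (X ω - -L) 0 ≤ L + B := fun ω => by
    rw [add_comm]; exact hinge_le hB (by linarith) le_rfl ω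
  have hlowM : ∀ s : ℝ, 0 ≤ s → (L - B) ^ s ≤ hingeMoment P X s (-L) := fun s hs => by
    calc (L - B) ^ s = ∫ _, (L - B) ^ s ∂P := by simp
      _ ≤ _ := integral_mono (integrable_const _) (integrable_hinge_rpow hX hB hs _) fun ω =>
        Real.rpow_le_rpow (by linarith) (hlow ω) hs
  have huppM : hingeMoment P X q (-L) ≤ (L + B) ^ q := by
    calc hingeMoment P X q (-L) ≤ ∫ _, (L + B) ^ q ∂P :=
        integral_mono (integrable_hinge_rpow hX hB (by linarith) _) (integrable_const _) fun ω =>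
          Real.rpow_le_rpow (le_max_right _ _) (hupp ω) (by linarith)
      _ = _ := by simp
  -- The dual objective is nonincreasing at -L: X + L lies in [L-B, L+B], and `hL` bounds the ratio
  -- of the endpoints by A^(k-1).
  have hstart : hingeMoment P X q (-L) ^ (1 / k) ≤ A * hingeMoment P X (q - 1) (-L) := by
    have e1 : q * (1 / k) = q - 1 := by
      rw [mul_one_div, hkq.symm.div_conj_eq_sub_one]
    calc hingeMoment P X q (-L) ^ (1 / k) ≤ ((L + B) ^ q) ^ (1 / k) :=
          Real.rpow_le_rpow (hingeMoment_nonneg _ _) huppM (one_div_nonneg.2 hkq.nonneg)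
      _ = (L + B) ^ (q - 1) := by rw [← Real.rpow_mul (by linarith), e1]
      _ ≤ ((L - B) * A ^ (k - 1)) ^ (q - 1) :=
          Real.rpow_le_rpow (by linarith) hL (by linarith)
      _ = A * (L - B) ^ (q - 1) := by
          rw [Real.mul_rpow (by linarith) (Real.rpow_nonneg hA.le _), ← Real.rpow_mul hA.le]
          have : (k - 1) * (q - 1) = 1 := by
            have := hkq.sub_one_mul_conj
            nlinarith
          rw [this, Real.rpow_one, mul_comm]
      _ ≤ _ := mul_le_mul_of_nonneg_left (hlowM _ (by linarith)) hA.le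
  have hcont := continuous_hingeMoment (P := P) hX hB (s := q) (by linarith)
  -- If the derivative becomes nonnegative before the moment vanishes, the intermediate value
  -- theorem yields a stationary point.
  by_cases hcase : ∃ t ∈ Set.Icc (-L) B, 0 < hingeMoment P X q t ∧
      A * hingeMoment P X (q - 1) t ≤ hingeMoment P X q t ^ (1 / k)
  · obtain ⟨t₁, ht₁, hpos, hle⟩ := hcase
    have hF : ContinuousOn (fun t => A * hingeMoment P X (q - 1) t - hingeMoment P X q t ^ (1 / k))
        (Set.Icc (-L) t₁) :=
      (((continuous_hingeMoment hX hB (by linarith)).const_mul A).sub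
        (hcont.rpow_const fun _ => Or.inr (one_div_nonneg.2 hkq.nonneg))).continuousOn
    obtain ⟨t, ht, h0⟩ := intermediate_value_Icc' ht₁.1 hF ⟨sub_nonpos.2 hle, sub_nonneg.2 hstart⟩
    exact ⟨t, ⟨ht.1, ht.2.trans ht₁.2⟩, dualValue_le_robustValue_of_stationary hkq hτ hX hB
      (hpos.trans_le (hingeMoment_antitone hX hB (by linarith) ht.2)) (sub_eq_zero.1 h0)⟩
  -- Otherwise the dual objective decreases up to the first zero of the moment, the essential
  -- supremum of X. The dual value there is that point itself, and every smaller t is a lower bound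
  -- for the robust value.
  · push Not at hcase
    set S : Set ℝ := Set.Icc (-L) B ∩ hingeMoment P X q ⁻¹' {0} with hS
    have hSc : IsClosed S := isClosed_Icc.inter (isClosed_singleton.preimage hcont)
    have hSn : S.Nonempty := ⟨B, ⟨by linarith, le_rfl⟩, hingeMoment_self_eq_zero hB (by linarith)⟩
    have hSb : BddBelow S := ⟨-L, fun t ht => ht.1.1⟩
    obtain ⟨hI, h0⟩ := hSc.csInf_mem hSn hSb
    refine ⟨sInf S, hI, ?_⟩
    have h0' : hingeMoment P X q (sInf S) = 0 := h0
    have hne : -L < sInf S := hI.1.lt_of_ne fun h => by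
      have := hlowM q (by linarith)
      rw [h, h0'] at this
      exact absurd this (not_le.2 (Real.rpow_pos_of_pos (by linarith) _))
    rw [dualValue, h0', Real.zero_rpow (one_div_pos.2 (by linarith)).ne', mul_zero, add_zero]
    refine le_of_forall_lt_imp_le_of_dense fun t ht => ?_
    refine (le_max_left t (-L)).trans ?_
    have hlt : max t (-L) < sInf S := max_lt ht hne
    have hmem : max t (-L) ∈ Set.Icc (-L) B := ⟨le_max_right _ _, hlt.le.trans hI.2⟩
    have hpos : 0 < hingeMoment P X q (max t (-L)) :=
      (hingeMoment_nonneg _ _).lt_of_ne fun h => hlt.not_ge (csInf_le hSb ⟨hmem, h.symm⟩)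
    exact le_robustValue_of_gradient_nonneg hkq hτ hX hB hpos (hcase _ hmem hpos).le

end

/-! ### Concentration of empirical q-norms -/

section
variable {Ω : Type*} [MeasurableSpace Ω] {P : Measure Ω}

instance sampleLaw.instIsProbabilityMeasure [IsProbabilityMeasure P] (n : ℕ) :
    IsProbabilityMeasure (sampleLaw P n) := by
  unfold sampleLaw; infer_instance

theorem isProbabilityMeasure_empiricalMeasure {n : ℕ} (hn : n ≠ 0) (ω : Fin n → Ω) :
    IsProbabilityMeasure (empiricalMeasure ω) := by
  refine ⟨?_⟩
  simp [empiricalMeasure, ENNReal.inv_mul_cancel, hn]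

theorem integral_empiricalMeasure {n : ℕ} (ω : Fin n → Ω) {f : Ω → ℝ} (hf : Measurable f) :
    ∫ x, f x ∂empiricalMeasure ω = (∑ i, f (ω i)) / n := by
  have hi : ∀ i ∈ Finset.univ, Integrable f (Measure.dirac (ω i)) := fun i _ =>
    ⟨hf.aestronglyMeasurable, by
      rw [HasFiniteIntegral, lintegral_dirac' _ hf.enorm]; exact enorm_lt_top⟩
  rw [empiricalMeasure, integral_smul_measure, integral_finsetSum_measure hi]
  simp_rw [integral_dirac' f _ hf.stronglyMeasurable]
  simp [div_eq_inv_mul]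

/-- Combines e^x ≤ 1 + x + x² for |x| ≤ 1 with z² ≤ z. The quadratic term is thus controlled by the
mean, which makes the later bound of Bernstein rather than Hoeffding type. -/
theorem exp_mul_le {l z : ℝ} (hl : |l| ≤ 1) (h0 : 0 ≤ z) (h1 : z ≤ 1) :
    Real.exp (l * z) ≤ 1 + (l + l ^ 2) * z := by
  have habs : |l * z| ≤ 1 := by
    rw [abs_mul, abs_of_nonneg h0]
    exact mul_le_one₀ hl h0 h1
  have := (abs_le.1 (Real.abs_exp_sub_one_sub_id_le habs)).2
  nlinarith [mul_nonneg (sq_nonneg l) (mul_nonneg h0 (sub_nonneg.2 h1))]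

/-- Chernoff's bound; allowing both signs of l covers both tails. -/
theorem sampleLaw_exp_bound [IsProbabilityMeasure P] {Z : Ω → ℝ} (hZ : Measurable Z)
    (h0 : ∀ ω, 0 ≤ Z ω) (h1 : ∀ ω, Z ω ≤ 1) {l : ℝ} (hl : |l| ≤ 1) (n : ℕ) (c : ℝ) :
    (sampleLaw P n).real {ω | c ≤ l * ∑ i, Z (ω i)} ≤
      Real.exp (n * ((l + l ^ 2) * ∫ x, Z x ∂P) - c) := by
  have hZi : Integrable Z P := Integrable.of_bound hZ.aestronglyMeasurable 1
    (Filter.Eventually.of_forall fun ω => by rw [Real.norm_of_nonneg (h0 ω)]; exact h1 ω)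
  have hexpi : Integrable (fun x => Real.exp (l * Z x)) P := by
    refine Integrable.of_bound (hZ.const_mul l).exp.aestronglyMeasurable (Real.exp 1)
      (Filter.Eventually.of_forall fun ω => ?_)
    rw [Real.norm_of_nonneg (Real.exp_pos _).le, Real.exp_le_exp]
    refine (le_abs_self _).trans ?_
    rw [abs_mul, abs_of_nonneg (h0 ω)]
    exact mul_le_one₀ hl (h0 ω) (h1 ω)
  have hone : ∫ x, Real.exp (l * Z x) ∂P ≤ Real.exp ((l + l ^ 2) * ∫ x, Z x ∂P) := by
    calc ∫ x, Real.exp (l * Z x) ∂P ≤ ∫ x, (1 + (l + l ^ 2) * Z x) ∂P :=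
          integral_mono hexpi ((integrable_const _).add (hZi.const_mul _)) fun ω =>
            exp_mul_le hl (h0 ω) (h1 ω)
      _ = (l + l ^ 2) * ∫ x, Z x ∂P + 1 := by
          rw [integral_add (integrable_const _) (hZi.const_mul _), integral_const_mul]
          simp [add_comm]
      _ ≤ _ := Real.add_one_le_exp _
  have hsum : ∀ ω : Fin n → Ω, Real.exp (l * ∑ i, Z (ω i)) = ∏ i, Real.exp (l * Z (ω i)) :=
    fun ω => by rw [Finset.mul_sum, Real.exp_sum]
  have hpi : ∫ ω, Real.exp (l * ∑ i, Z (ω i)) ∂sampleLaw P n =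
      (∫ x, Real.exp (l * Z x) ∂P) ^ n := by
    simp_rw [hsum, sampleLaw]
    rw [integral_fintype_prod_eq_pow (fun x => Real.exp (l * Z x)), Fintype.card_fin]
  have hpii : Integrable (fun ω : Fin n → Ω => Real.exp (l * ∑ i, Z (ω i))) (sampleLaw P n) := by
    simp_rw [hsum, sampleLaw]
    exact Integrable.fintype_prod (f := fun _ x => Real.exp (l * Z x)) fun _ => hexpi
  have hM := mul_meas_ge_le_integral_of_nonneg
    (Filter.Eventually.of_forall fun ω => (Real.exp_pos _).le) hpii (Real.exp c)
  simp_rw [Real.exp_le_exp] at hM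
  rw [hpi] at hM
  rw [Real.exp_sub, le_div_iff₀ (Real.exp_pos _), mul_comm, Real.exp_nat_mul]
  exact hM.trans (pow_le_pow_left₀ (integral_nonneg fun _ => (Real.exp_pos _).le) hone n)

theorem add_rpow_ge_add_mul {r ε q : ℝ} (hq : 1 ≤ q) (hr : 0 ≤ r) (hε : 0 < ε) :
    r ^ q + ε * max r ε ^ (q - 1) ≤ (r + ε) ^ q := by
  rcases le_total r ε with h | h
  · rw [max_eq_right h, mul_comm, ← Real.rpow_add_one hε.ne', sub_add_cancel]
    exact Real.add_rpow_le_rpow_add hr hε.le hq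
  · have hr0 : 0 < r := hε.trans_le h
    have h1 := one_add_mul_self_le_rpow_one_add (s := ε / r) (by
      have : 0 ≤ ε / r := by positivity
      linarith) hq
    have h2 : (r + ε) ^ q = r ^ q * (1 + ε / r) ^ q := by
      rw [← Real.mul_rpow hr (by positivity)]
      congr 1
      field_simp
    have h3 : 1 + ε / r ≤ 1 + q * (ε / r) := by
      have : 0 ≤ ε / r := by positivity
      nlinarith
    rw [max_eq_left h, h2, Real.rpow_sub_one hr0.ne']
    calc r ^ q + ε * (r ^ q / r) = r ^ q * (1 + ε / r) := by ring
      _ ≤ _ := mul_le_mul_of_nonneg_left (h3.trans h1) (Real.rpow_nonneg hr q)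

theorem sub_rpow_le_sub_mul {r ε q : ℝ} (hq : 1 ≤ q) (hε : 0 < ε) (h : ε ≤ r) :
    (r - ε) ^ q ≤ r ^ q - ε * max r ε ^ (q - 1) := by
  have hr0 : 0 < r := hε.trans_le h
  rw [max_eq_left h]
  have h1 : (r - ε) ^ q ≤ (r - ε) * r ^ (q - 1) := by
    rcases eq_or_lt_of_le (sub_nonneg.2 h) with h0 | h0
    · rw [← h0, Real.zero_rpow (by linarith), zero_mul]
    · have : (r - ε) ^ q = (r - ε) ^ (q - 1) * (r - ε) := by
        rw [← Real.rpow_add_one h0.ne', sub_add_cancel]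
      rw [this, mul_comm]
      exact mul_le_mul_of_nonneg_left
        (Real.rpow_le_rpow h0.le (by linarith) (by linarith)) h0.le
  have h2 : r ^ q = r ^ (q - 1) * r := by rw [← Real.rpow_add_one hr0.ne', sub_add_cancel]
  rw [h2]
  linarith [h1, mul_comm r (r ^ (q - 1)), sub_mul r ε (r ^ (q - 1))]

/-- Moving r by ε changes r^q by at least ε max(r,ε)^(q-1), so a smaller error in the moment is
harmless. The maximum replaces the derivative, which degenerates near r = 0; when r < ε the lower
estimate is free because a^(1/q) ≥ 0. -/
theorem abs_rpow_sub_le_of_abs_sub_le {a r ε q : ℝ} (hq : 1 ≤ q) (ha : 0 ≤ a) (hr : 0 ≤ r)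
    (hε : 0 < ε) (h : |a - r ^ q| ≤ ε * max r ε ^ (q - 1)) : |a ^ (1 / q) - r| ≤ ε := by
  have hq0 : 0 < q := by linarith
  have key : ∀ y : ℝ, 0 ≤ y → (y ^ q) ^ (1 / q) = y := fun y hy => by
    rw [← Real.rpow_mul hy, mul_one_div_cancel hq0.ne', Real.rpow_one]
  obtain ⟨h1, h2⟩ := abs_le.1 h
  have hq' : 0 ≤ 1 / q := by positivity
  refine abs_le.2 ⟨?_, ?_⟩
  · rcases le_or_gt ε r with hr' | hr'
    · have h3 : (r - ε) ^ q ≤ a := (sub_rpow_le_sub_mul hq hε hr').trans (by linarith)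
      have h4 := Real.rpow_le_rpow (Real.rpow_nonneg (sub_nonneg.2 hr') q) h3 hq'
      rw [key _ (sub_nonneg.2 hr')] at h4
      linarith
    · linarith [Real.rpow_nonneg ha (1 / q)]
  · have h3 : a ≤ (r + ε) ^ q := le_trans (by linarith) (add_rpow_ge_add_mul hq hr hε)
    have h4 := Real.rpow_le_rpow ha h3 hq'
    rw [key _ (by linarith)] at h4
    linarith

/-- Concentration of the `q`-norm of a sample. -/
theorem sampleLaw_norm_concentration [IsProbabilityMeasure P] {Z : Ω → ℝ} (hZ : Measurable Z)
    (h0 : ∀ ω, 0 ≤ Z ω) (h1 : ∀ ω, Z ω ≤ 1) {q ε : ℝ} (hq : 1 ≤ q) (hε : 0 < ε) (hε1 : ε ≤ 1)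
    {n : ℕ} (hn : n ≠ 0) :
    (sampleLaw P n).real {ω | ε < |((∑ i, Z (ω i)) / n) ^ (1 / q) - (∫ x, Z x ∂P) ^ (1 / q)|} ≤
      2 * Real.exp (-(n * ε ^ max 2 q / 4)) := by
  set μ := ∫ x, Z x ∂P with hμ
  have hn0 : (0 : ℝ) < n := by positivity
  have hμ0 : 0 ≤ μ := integral_nonneg h0
  have hμ1 : μ ≤ 1 := by
    calc μ ≤ ∫ _, (1 : ℝ) ∂P := integral_mono_of_nonneg (Filter.Eventually.of_forall h0)
          (integrable_const _) (Filter.Eventually.of_forall h1)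
      _ = 1 := by simp
  set r := μ ^ (1 / q) with hr
  have hr0 : 0 ≤ r := Real.rpow_nonneg hμ0 _
  have hr1 : r ≤ 1 := Real.rpow_le_one hμ0 hμ1 (by positivity)
  have hrq : r ^ q = μ := by
    rw [hr, ← Real.rpow_mul hμ0, one_div_mul_cancel (by linarith), Real.rpow_one]
  set ρ := max r ε with hρ
  have hρ0 : 0 < ρ := lt_max_of_lt_right hε
  have hρ1 : ρ ≤ 1 := max_le hr1 hε1
  have hερ : ε ≤ ρ := le_max_right _ _
  -- This minimises the Chernoff exponent l²ρ^q - lερ^(q-1), with minimum -ε²ρ^(q-2)/4.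
  set l := ε / (2 * ρ) with hl
  have hl0 : 0 < l := by positivity
  have hl1 : l ≤ 1 := by rw [hl, div_le_one (by positivity)]; linarith
  set η := ε * ρ ^ (q - 1) with hη
  have hμρ : μ ≤ ρ ^ q := by
    rw [← hrq]; exact Real.rpow_le_rpow hr0 (le_max_left _ _) (by linarith)
  have hρq : ρ ^ q = ρ ^ (q - 2) * ρ ^ 2 := by
    rw [← Real.rpow_natCast, ← Real.rpow_add hρ0]; norm_num
  have hρq1 : ρ ^ (q - 1) = ρ ^ (q - 2) * ρ := by
    rw [← Real.rpow_add_one hρ0.ne']; congr 1; ring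
  -- Origin of max{2,q}: over ρ in [ε,1] the right side is least at ρ = ε if q ≥ 2, and at ρ = 1 if
  -- q ≤ 2.
  have hexp : ε ^ max 2 q ≤ ε ^ 2 * ρ ^ (q - 2) := by
    rcases le_total 2 q with h | h
    · rw [max_eq_right h]
      have : ε ^ q = ε ^ 2 * ε ^ (q - 2) := by
        rw [← Real.rpow_natCast, ← Real.rpow_add hε]; norm_num
      rw [this]
      exact mul_le_mul_of_nonneg_left (Real.rpow_le_rpow hε.le hερ (by linarith)) (sq_nonneg ε)
    · rw [max_eq_left h, Real.rpow_two]
      exact le_mul_of_one_le_right (sq_nonneg ε)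
        (Real.one_le_rpow_of_pos_of_le_one_of_nonpos hρ0 hρ1 (by linarith))
  have hexponent : n * (l ^ 2 * μ - l * η) ≤ -(n * ε ^ max 2 q / 4) := by
    have e1 : l ^ 2 * ρ ^ q - l * η = -(ε ^ 2 * ρ ^ (q - 2) / 4) := by
      rw [hη, hρq, hρq1, hl]; field_simp; ring
    have e2 : l ^ 2 * μ ≤ l ^ 2 * ρ ^ q := mul_le_mul_of_nonneg_left hμρ (sq_nonneg l)
    have e3 : l ^ 2 * μ - l * η ≤ -(ε ^ max 2 q / 4) := by linarith
    calc n * (l ^ 2 * μ - l * η) ≤ n * -(ε ^ max 2 q / 4) := mul_le_mul_of_nonneg_left e3 hn0.le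
      _ = _ := by ring
  have hup := sampleLaw_exp_bound (P := P) hZ h0 h1 (l := l) (by rwa [abs_of_pos hl0]) n
    (l * (n * (μ + η)))
  have hdown := sampleLaw_exp_bound (P := P) hZ h0 h1 (l := -l) (by rwa [abs_neg, abs_of_pos hl0])
    n (-l * (n * (μ - η)))
  rw [← hμ] at hup hdown
  have hup' := hup.trans (Real.exp_le_exp.2 ((show _ = n * (l ^ 2 * μ - l * η) by ring).trans_le
    hexponent))
  have hdown' := hdown.trans (Real.exp_le_exp.2
    ((show _ = n * (l ^ 2 * μ - l * η) by ring).trans_le hexponent))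
  refine (measureReal_mono (s₂ := {ω | l * (n * (μ + η)) ≤ l * ∑ i, Z (ω i)} ∪
    {ω | -l * (n * (μ - η)) ≤ -l * ∑ i, Z (ω i)}) ?_).trans
    ((measureReal_union_le _ _).trans (by linarith))
  intro ω hω
  by_contra hcon
  simp only [Set.mem_union, Set.mem_ofPred_eq, not_or, not_le, neg_mul, neg_lt_neg_iff] at hcon
  have c1 := lt_of_mul_lt_mul_left hcon.1 hl0.le
  have c2 := lt_of_mul_lt_mul_left hcon.2 hl0.le
  refine absurd (abs_rpow_sub_le_of_abs_sub_le (a := (∑ i, Z (ω i)) / n) hq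
    (div_nonneg (Finset.sum_nonneg fun i _ => h0 _) hn0.le) hr0 hε ?_) (not_le.2 hω)
  rw [hrq, abs_le]
  constructor
  · rw [neg_le_sub_iff_le_add, ← sub_le_iff_le_add, le_div_iff₀ hn0]
    change (μ - η) * n ≤ _
    linarith [mul_comm (n : ℝ) (μ - η)]
  · rw [sub_le_iff_le_add', div_le_iff₀ hn0]
    change _ ≤ (μ + η) * n
    linarith [mul_comm (n : ℝ) (μ + η)]

end

/-! ### Uniform deviation of the dual objective -/

section
variable {Ω : Type*} [MeasurableSpace Ω] {P : Measure Ω} {X : Ω → ℝ} {B : ℝ}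

theorem eLpNorm_hinge [IsProbabilityMeasure P] (hX : Measurable X) (hB : ∀ ω, |X ω| ≤ B) {q : ℝ}
    (hq : 1 ≤ q) (t : ℝ) : eLpNorm (fun ω => max (X ω - t) 0) (ENNReal.ofReal q) P =
      ENNReal.ofReal (hingeMoment P X q t ^ (1 / q)) := by
  rw [(memLp_hinge hX hB _ t).eLpNorm_eq_integral_rpow_norm (by simp; linarith)
    ENNReal.ofReal_ne_top, ENNReal.toReal_ofReal (by linarith), one_div]
  simp_rw [Real.norm_of_nonneg (le_max_right _ (0 : ℝ))]
  rfl

/-- Minkowski's inequality applied to (X-s)₊ ≤ (X-t)₊ + (t-s). -/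
theorem abs_hingeMoment_rpow_sub_le [IsProbabilityMeasure P] (hX : Measurable X)
    (hB : ∀ ω, |X ω| ≤ B) {q : ℝ} (hq : 1 ≤ q) {s t : ℝ} (hst : s ≤ t) :
    |hingeMoment P X q t ^ (1 / q) - hingeMoment P X q s ^ (1 / q)| ≤ t - s := by
  have hq' : 0 ≤ 1 / q := one_div_nonneg.2 (by linarith)
  have h1 : hingeMoment P X q t ^ (1 / q) ≤ hingeMoment P X q s ^ (1 / q) :=
    Real.rpow_le_rpow (hingeMoment_nonneg _ _) (hingeMoment_antitone hX hB (by linarith) hst) hq'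
  have h2 : hingeMoment P X q s ^ (1 / q) ≤ hingeMoment P X q t ^ (1 / q) + (t - s) := by
    rw [← ENNReal.ofReal_le_ofReal_iff (add_nonneg (Real.rpow_nonneg (hingeMoment_nonneg _ _) _)
      (sub_nonneg.2 hst)), ENNReal.ofReal_add (Real.rpow_nonneg (hingeMoment_nonneg _ _) _)
      (sub_nonneg.2 hst), ← eLpNorm_hinge hX hB hq, ← eLpNorm_hinge hX hB hq]
    have hc : eLpNorm (fun _ : Ω => t - s) (ENNReal.ofReal q) P = ENNReal.ofReal (t - s) := by
      rw [eLpNorm_const' _ (by simp; linarith) ENNReal.ofReal_ne_top]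
      simp [Real.enorm_of_nonneg (sub_nonneg.2 hst)]
    rw [← hc]
    refine le_trans (eLpNorm_mono_real fun ω => ?_) (eLpNorm_add_le
      (memLp_hinge hX hB (ENNReal.ofReal q) t).1 aestronglyMeasurable_const
      (ENNReal.one_le_ofReal.2 hq))
    rw [Real.norm_of_nonneg (le_max_right _ _)]
    have := le_max_left (X ω - t) 0
    have := le_max_right (X ω - t) 0
    exact max_le (by simp only [Pi.add_apply]; linarith) (by simp only [Pi.add_apply]; linarith)
  rw [abs_le]
  constructor <;> linarith

theorem hingeMoment_rpow_eq_mul {q D : ℝ} (hq : 1 ≤ q) (hD : 0 < D) (t : ℝ) :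
    hingeMoment P X q t ^ (1 / q) = D * (∫ ω, (max (X ω - t) 0 / D) ^ q ∂P) ^ (1 / q) := by
  have hDq := Real.rpow_pos_of_pos hD q
  simp_rw [Real.div_rpow (le_max_right _ _) hD.le, integral_div]
  change _ = D * (hingeMoment P X q t / D ^ q) ^ (1 / q)
  rw [Real.div_rpow (hingeMoment_nonneg _ _) hDq.le, ← Real.rpow_mul hD.le,
    mul_one_div_cancel (by linarith), Real.rpow_one, mul_div_cancel₀ _ hD.ne']

/-- Union bound over a grid of mesh εD, where D = B + L. Both norms are 1-Lipschitz in t, so passing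
to the grid costs 2εD on top of the deviation εD there; the factor 4 has slack. At most 2/ε grid
points, each with two tails, give the prefactor 4/ε. -/
theorem sampleLaw_dualValue_deviation [IsProbabilityMeasure P] (hX : Measurable X)
    (hB : ∀ ω, |X ω| ≤ B) {A q L ε : ℝ} (hA : 0 < A) (hq : 1 ≤ q) (hL : 0 < B + L) (hε : 0 < ε)
    (hε1 : ε ≤ 1) {n : ℕ} (hn : n ≠ 0) :
    (sampleLaw P n).real {ω | ∃ t ∈ Set.Icc (-L) B, 4 * A * (B + L) * ε <
      |dualValue A q P X t - dualValue A q (empiricalMeasure ω) X t|} ≤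
      4 / ε * Real.exp (-(n * ε ^ max 2 q / 4)) := by
  set D := B + L with hD
  set N := ⌊1 / ε⌋₊ + 1 with hN
  set u : ℕ → ℝ := fun j => -L + j * (ε * D) with hu
  set Z : ℕ → Ω → ℝ := fun j ω => (max (X ω - u j) 0 / D) ^ q with hZdef
  have hεD : 0 < ε * D := mul_pos hε hL
  have hZm : ∀ j, Measurable (Z j) := fun j =>
    (((hX.sub_const _).max measurable_const).div_const D).pow_const q
  have hZ0 : ∀ j ω, 0 ≤ max (X ω - u j) 0 / D := fun j ω => div_nonneg (le_max_right _ _) hL.le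
  have hZ1 : ∀ j ω, max (X ω - u j) 0 / D ≤ 1 := fun j ω => by
    rw [div_le_one hL]
    refine hinge_le hB hL.le ?_ ω
    have : 0 ≤ (j : ℝ) * (ε * D) := by positivity
    simp only [hu]; linarith
  have hsub : {ω | ∃ t ∈ Set.Icc (-L) B, 4 * A * D * ε <
      |dualValue A q P X t - dualValue A q (empiricalMeasure ω) X t|} ⊆
      ⋃ j ∈ Finset.range N, {ω : Fin n → Ω |
        ε < |((∑ i, Z j (ω i)) / n) ^ (1 / q) - (∫ x, Z j x ∂P) ^ (1 / q)|} := by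
    rintro ω ⟨t, ⟨ht1, ht2⟩, hdev⟩
    have := isProbabilityMeasure_empiricalMeasure hn ω
    set j := ⌊(t + L) / (ε * D)⌋₊ with hj
    have hj0 : 0 ≤ (t + L) / (ε * D) := div_nonneg (by linarith) hεD.le
    have hjle : u j ≤ t := by
      have := (le_div_iff₀ hεD).1 (Nat.floor_le hj0)
      simp only [hu]; linarith
    have hjge : t - u j ≤ ε * D := by
      have := (div_lt_iff₀ hεD).1 (Nat.lt_floor_add_one ((t + L) / (ε * D)))
      rw [← hj] at this
      simp only [hu]; linarith
    have hjN : j < N := by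
      refine Nat.lt_succ_of_le (Nat.floor_mono ?_)
      rw [div_le_div_iff₀ hεD hε]
      nlinarith
    refine Set.mem_biUnion (Finset.mem_coe.2 (Finset.mem_range.2 hjN)) ?_
    by_contra hcon
    rw [Set.mem_ofPred_eq, not_lt, ← integral_empiricalMeasure ω (hZm j)] at hcon
    have e1 := abs_hingeMoment_rpow_sub_le (P := P) hX hB hq hjle
    have e2 := abs_hingeMoment_rpow_sub_le (P := empiricalMeasure ω) hX hB hq hjle
    have e3 : |hingeMoment (empiricalMeasure ω) X q (u j) ^ (1 / q) -
        hingeMoment P X q (u j) ^ (1 / q)| ≤ D * ε := by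
      rw [hingeMoment_rpow_eq_mul hq hL, hingeMoment_rpow_eq_mul hq hL, ← mul_sub, abs_mul,
        abs_of_pos hL]
      exact mul_le_mul_of_nonneg_left hcon hL.le
    have e4 : |hingeMoment P X q t ^ (1 / q) - hingeMoment (empiricalMeasure ω) X q t ^ (1 / q)| ≤
        4 * (D * ε) := by
      rw [abs_le] at e1 e2 e3 ⊢
      have : 0 < D * ε := mul_pos hL hε
      constructor <;> linarith
    refine absurd hdev (not_lt.2 ?_)
    rw [dualValue, dualValue, add_sub_add_left_eq_sub, ← mul_sub, abs_mul, abs_of_pos hA]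
    calc _ ≤ A * (4 * (D * ε)) := mul_le_mul_of_nonneg_left e4 hA.le
      _ = _ := by ring
  have hNle : (N : ℝ) ≤ 2 / ε := by
    have h1 := Nat.floor_le (one_div_pos.2 hε).le
    have h2 : 1 ≤ 1 / ε := by rwa [le_div_iff₀ hε, one_mul]
    rw [hN, Nat.cast_add_one, show 2 / ε = 1 / ε + 1 / ε by ring]
    linarith
  have hbound : ∀ j ∈ Finset.range N, (sampleLaw P n).real {ω : Fin n → Ω |
      ε < |((∑ i, Z j (ω i)) / n) ^ (1 / q) - (∫ x, Z j x ∂P) ^ (1 / q)|} ≤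
      2 * Real.exp (-(n * ε ^ max 2 q / 4)) := fun j _ =>
    sampleLaw_norm_concentration (hZm j) (fun ω => Real.rpow_nonneg (hZ0 j ω) q)
      (fun ω => Real.rpow_le_one (hZ0 j ω) (hZ1 j ω) (by linarith)) hq hε hε1 hn
  calc _ ≤ _ := measureReal_mono hsub (measure_ne_top _ _)
    _ ≤ _ := measureReal_biUnion_finset_le _ _
    _ ≤ _ := Finset.sum_le_sum hbound
    _ = N * (2 * Real.exp (-(n * ε ^ max 2 q / 4))) := by
        rw [Finset.sum_const, Finset.card_range, nsmul_eq_mul]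
    _ ≤ 2 / ε * (2 * Real.exp (-(n * ε ^ max 2 q / 4))) :=
        mul_le_mul_of_nonneg_right hNle (by positivity)
    _ = _ := by ring

/-- Each measure's dual optimizer is inserted into weak duality for the other, so closeness is
needed only on the common range. -/
theorem abs_robustValue_sub_le {P' : Measure Ω} {k q τ : ℝ} (hkq : k.HolderConjugate q)
    (hτ : 0 < τ) [IsProbabilityMeasure P] [IsProbabilityMeasure P'] (hX : Measurable X)
    (hB : ∀ ω, |X ω| ≤ B) (hB0 : 0 ≤ B) {L : ℝ} (hBL : B < L)
    (hL : L + B ≤ (L - B) * ((1 + k * (k - 1) * τ) ^ (1 / k)) ^ (k - 1)) {ε : ℝ}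
    (h : ∀ t ∈ Set.Icc (-L) B, |dualValue ((1 + k * (k - 1) * τ) ^ (1 / k)) q P X t -
      dualValue ((1 + k * (k - 1) * τ) ^ (1 / k)) q P' X t| ≤ ε) :
    |robustValue (cressieRead k) τ P X - robustValue (cressieRead k) τ P' X| ≤ ε := by
  obtain ⟨t, ht, h1⟩ := exists_dualValue_le_robustValue (P := P) hkq hτ hX hB hB0 hBL hL
  obtain ⟨t', ht', h1'⟩ := exists_dualValue_le_robustValue (P := P') hkq hτ hX hB hB0 hBL hL
  have h2 := robustValue_le_dualValue (P := P) hkq hτ hX hB t'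
  have h2' := robustValue_le_dualValue (P := P') hkq hτ hX hB t
  have h3 := abs_le.1 (h t ht)
  have h3' := abs_le.1 (h t' ht')
  rw [abs_le]
  constructor <;> linarith

end

/-! ### The sample complexity upper bound -/

theorem one_lt_moment_radius {k τ : ℝ} (hk : 1 < k) (hτ : 0 < τ) :
    1 < (1 + k * (k - 1) * τ) ^ (1 / k) := by
  have : 0 < k * (k - 1) := mul_pos (by linarith) (by linarith)
  refine Real.one_lt_rpow ?_ (by positivity)
  have : 0 < k * (k - 1) * τ := by positivity
  linarith

theorem exists_dual_range {k τ B : ℝ} (hk : 1 < k) (hτ : 0 < τ) (hB : 0 < B) :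
    ∃ L, B < L ∧ L + B ≤ (L - B) * ((1 + k * (k - 1) * τ) ^ (1 / k)) ^ (k - 1) := by
  have hr : 1 < ((1 + k * (k - 1) * τ) ^ (1 / k)) ^ (k - 1) :=
    Real.one_lt_rpow (one_lt_moment_radius hk hτ) (by linarith)
  set r := ((1 + k * (k - 1) * τ) ^ (1 / k)) ^ (k - 1)
  have hr' : 0 < r - 1 := sub_pos.2 hr
  have h2 : 0 < 2 * B / (r - 1) := by positivity
  refine ⟨B + 2 * B / (r - 1), by linarith, le_of_eq ?_⟩
  field_simp
  ring

theorem saa_upper_bound {k τ B : ℝ} (hk : 1 < k) (hτ : 0 < τ) (hB : 0 < B) :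
    ∃ C : ℝ, 0 < C ∧ ∃ m : ℕ,
      ∀ (Ω : Type*) [MeasurableSpace Ω] (P : Measure Ω) [IsProbabilityMeasure P]
        (X : Ω → ℝ), Measurable X → (∀ ω, |X ω| ≤ B) →
      ∀ ε δ : ℝ, 0 < ε → ε ≤ B → 0 < δ → δ < 1 →
      ∀ n : ℕ,
        C * ε ^ (-(max 2 (k / (k - 1)))) * (1 + Real.log (B / ε)) ^ m
            * (1 + Real.log (1 / δ)) ≤ (n : ℝ) →
        ENNReal.ofReal (1 - δ) ≤
          sampleLaw P n {ω | |robustValue (cressieRead k) τ P X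
            - saaValue (cressieRead k) τ X ω| ≤ ε} := by
  have hkq : k.HolderConjugate (k / (k - 1)) := Real.HolderConjugate.conjExponent hk
  set q := k / (k - 1) with hq
  have hq1 := hkq.symm.lt
  obtain ⟨L, hBL, hL⟩ := exists_dual_range hk hτ hB
  have hA := one_lt_moment_radius hk hτ
  set A := (1 + k * (k - 1) * τ) ^ (1 / k) with hAdef
  have hD : 0 < B + L := by linarith
  set E := 4 * A * (B + L) with hE
  have hE0 : 0 < E := by positivity
  have hEB : B ≤ E := by
    have : B + L ≤ A * (B + L) := le_mul_of_one_le_left hD.le hA.le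
    rw [hE]; linarith
  have hlogE : 0 ≤ Real.log (4 * E / B) :=
    Real.log_nonneg (by rw [le_div_iff₀ hB]; linarith)
  -- With e = ε/E, the failure bound is at most δ once n e^max{2,q}/4 ≥ log(4E/B) + log(B/ε) +
  -- log(1/δ). The product of the three factors 1 + log dominates this sum, so m = 1 suffices.
  refine ⟨4 * E ^ max 2 q * (1 + Real.log (4 * E / B)), by positivity, 1, ?_⟩
  intro Ω _ P _ X hX hXB ε δ hε hεB hδ hδ1 n hn
  set e := ε / E with he
  have he0 : 0 < e := div_pos hε hE0
  have he1 : e ≤ 1 := (div_le_one hE0).2 (hεB.trans hEB)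
  have hlogε : 0 ≤ Real.log (B / ε) := Real.log_nonneg (by rwa [le_div_iff₀ hε, one_mul])
  have hlogδ : 0 ≤ Real.log (1 / δ) := Real.log_nonneg (by rw [le_div_iff₀ hδ]; linarith)
  -- The empty sample must be excluded: its empirical measure is zero.
  have hn0 : n ≠ 0 := by
    rintro rfl
    refine absurd hn (not_le.2 ?_)
    rw [Nat.cast_zero]
    positivity
  have hexp : Real.log (4 / e) + Real.log (1 / δ) ≤ n * e ^ max 2 q / 4 := by
    have h1 : Real.log (4 / e) = Real.log (4 * E / B) + Real.log (B / ε) := by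
      rw [← Real.log_mul (by positivity) (by positivity)]
      congr 1
      rw [he]; field_simp
    have h2 : e ^ max 2 q * (E ^ max 2 q * ε ^ (-max 2 q)) = 1 := by
      rw [he, Real.div_rpow hε.le hE0.le, Real.rpow_neg hε.le]
      field_simp
    have h3 := mul_le_mul_of_nonneg_right hn (show 0 ≤ e ^ max 2 q / 4 by positivity)
    have h4 : 4 * E ^ max 2 q * (1 + Real.log (4 * E / B)) * ε ^ (-max 2 q) *
        (1 + Real.log (B / ε)) ^ 1 * (1 + Real.log (1 / δ)) * (e ^ max 2 q / 4) =
        (1 + Real.log (4 * E / B)) * (1 + Real.log (B / ε)) * (1 + Real.log (1 / δ)) *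
          (e ^ max 2 q * (E ^ max 2 q * ε ^ (-max 2 q))) := by ring
    rw [h4, h2, mul_one] at h3
    rw [h1]
    refine le_trans ?_ (h3.trans_eq (mul_div_assoc _ _ _).symm)
    nlinarith [mul_nonneg hlogE hlogε, mul_nonneg hlogE hlogδ, mul_nonneg hlogε hlogδ,
      mul_nonneg (mul_nonneg hlogE hlogε) hlogδ]
  have hdev := sampleLaw_dualValue_deviation (P := P) hX hXB (A := A) (L := L) (by linarith)
    hq1.le hD he0 he1 hn0
  have hsmall : 4 / e * Real.exp (-(n * e ^ max 2 q / 4)) ≤ δ := by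
    have h1 : Real.exp (-(n * e ^ max 2 q / 4)) ≤ Real.exp (-(Real.log (4 / e) + Real.log (1 / δ))) :=
      Real.exp_le_exp.2 (neg_le_neg hexp)
    rw [neg_add, Real.exp_add, Real.exp_neg (Real.log _), Real.exp_neg (Real.log _), Real.exp_log (by positivity),
      Real.exp_log (by positivity)] at h1
    calc _ ≤ 4 / e * ((4 / e)⁻¹ * (1 / δ)⁻¹) := mul_le_mul_of_nonneg_left h1 (by positivity)
      _ = δ := by field_simp
  have hEe : E * e = ε := mul_div_cancel₀ _ hE0.ne'
  rw [← hE, hEe] at hdev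
  set bad : Set (Fin n → Ω) := {ω | ∃ t ∈ Set.Icc (-L) B, ε <
      |dualValue A q P X t - dualValue A q (empiricalMeasure ω) X t|} with hbad
  have hsub : badᶜ ⊆ {ω | |robustValue (cressieRead k) τ P X
      - saaValue (cressieRead k) τ X ω| ≤ ε} := by
    intro ω hω
    have := isProbabilityMeasure_empiricalMeasure hn0 ω
    rw [hbad, Set.mem_compl_iff, Set.mem_ofPred_eq] at hω
    push Not at hω
    exact abs_robustValue_sub_le hkq hτ hX hXB hB.le hBL hL hω
  -- Subadditivity suffices here, so measurability of `bad` is not needed.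
  have hcover : (1 : ℝ) ≤ (sampleLaw P n).real bad + (sampleLaw P n).real badᶜ := by
    have := measureReal_union_le (μ := sampleLaw P n) bad badᶜ
    rwa [Set.union_compl_self, probReal_univ] at this
  calc ENNReal.ofReal (1 - δ) ≤ ENNReal.ofReal ((sampleLaw P n).real badᶜ) :=
        ENNReal.ofReal_le_ofReal (by linarith)
    _ = sampleLaw P n badᶜ := ofReal_measureReal
    _ ≤ _ := measure_mono hsub

/-! ### Le Cam's method on finite spaces -/

theorem sampleLaw_real_eq_sum {α : Type*} [Fintype α] [MeasurableSpace α]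
    [MeasurableSingletonClass α] (P : Measure α) [IsProbabilityMeasure P] (n : ℕ)
    (s : Finset (Fin n → α)) :
    (sampleLaw P n).real s = ∑ x ∈ s, ∏ i, P.real {x i} := by
  rw [← sum_measureReal_singleton]
  refine Finset.sum_congr rfl fun x _ => ?_
  simp [sampleLaw, Measure.real, Measure.pi_singleton, ENNReal.toReal_prod]

/-- Cauchy–Schwarz comparison of two product measures in terms of the `χ²`-divergence. -/
theorem sampleLaw_real_sq_le {α : Type*} [Fintype α] [MeasurableSpace α]
    [MeasurableSingletonClass α] (P Q : Measure α) [IsProbabilityMeasure P]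
    [IsProbabilityMeasure Q] (hP : ∀ a, 0 < P.real {a}) (n : ℕ) (s : Set (Fin n → α)) :
    (sampleLaw Q n).real s ^ 2 ≤
      (sampleLaw P n).real s * (∑ a, Q.real {a} ^ 2 / P.real {a}) ^ n := by
  classical
  obtain ⟨s, rfl⟩ := s.toFinite.exists_finset_coe
  have hv : ∀ x : Fin n → α, 0 < ∏ i, P.real {x i} := fun x => Finset.prod_pos fun i _ => hP _
  rw [sampleLaw_real_eq_sum, sampleLaw_real_eq_sum, Fintype.sum_pow]
  have h0 : ∀ x : Fin n → α, 0 ≤ ∏ i, Q.real {x i} ^ 2 / P.real {x i} := fun x =>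
    Finset.prod_nonneg fun i _ => div_nonneg (sq_nonneg _) (hP _).le
  calc _ ≤ (∑ x ∈ s, ∏ i, P.real {x i}) * ∑ x ∈ s, ∏ i, Q.real {x i} ^ 2 / P.real {x i} := by
        refine Finset.sum_sq_le_sum_mul_sum_of_sq_le_mul s (fun x _ => (hv x).le)
          (fun x _ => h0 x) fun x _ => le_of_eq ?_
        rw [Finset.prod_div_distrib, Finset.prod_pow, mul_div_cancel₀ _ (hv x).ne']
    _ ≤ _ := mul_le_mul_of_nonneg_left
        (Finset.sum_le_sum_of_subset_of_nonneg (Finset.subset_univ s) fun x _ _ => h0 x)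
        (Finset.sum_nonneg fun x _ => (hv x).le)

/-- Le Cam's two-point method. -/
theorem le_cam {α : Type*} [Fintype α] [MeasurableSpace α]
    [MeasurableSingletonClass α] (P Q : Measure α) [IsProbabilityMeasure P]
    [IsProbabilityMeasure Q] (hP : ∀ a, 0 < P.real {a}) {n : ℕ}
    (hn : (∑ a, Q.real {a} ^ 2 / P.real {a}) ^ n ≤ 9 / 4) (r : Measure α → ℝ) {ε : ℝ}
    (hr : 2 * ε ≤ |r P - r Q|) (T : (Fin n → α) → ℝ) :
    ∃ P : Measure α, IsProbabilityMeasure P ∧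
      ENNReal.ofReal (1 / 4) ≤ sampleLaw P n {ω | ε ≤ |T ω - r P|} := by
  by_contra! hcon
  have key : ∀ P : Measure α, IsProbabilityMeasure P →
      (sampleLaw P n).real {ω | ε ≤ |T ω - r P|} < 1 / 4 := fun P hP => by
    have := hcon P hP
    rw [← ofReal_measureReal] at this
    exact (ENNReal.ofReal_lt_ofReal_iff (by norm_num)).1 this
  have h1 := key P inferInstance
  have h2 := key Q inferInstance
  have h3 := sampleLaw_real_sq_le P Q hP n {ω | ε ≤ |T ω - r P|}
  have h4 : (1 : ℝ) ≤ (sampleLaw Q n).real {ω | ε ≤ |T ω - r P|} +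
      (sampleLaw Q n).real {ω | ε ≤ |T ω - r Q|} := by
    have huniv : {ω | ε ≤ |T ω - r P|} ∪ {ω | ε ≤ |T ω - r Q|} = Set.univ := by
      refine Set.eq_univ_of_forall fun ω => ?_
      by_contra hω
      simp only [Set.mem_union, Set.mem_ofPred_eq, not_or, not_le] at hω
      have := abs_sub_le (r P) (T ω) (r Q)
      rw [abs_sub_comm (r P) (T ω)] at this
      linarith [hω.1, hω.2]
    have := measureReal_union_le (μ := sampleLaw Q n) {ω | ε ≤ |T ω - r P|} {ω | ε ≤ |T ω - r Q|}
    rwa [huniv, probReal_univ] at this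
  -- The constant 9/4 is chosen so that this bound equals (3/4)²; together with an error below 1/4
  -- for r Q, the two events cannot cover the space.
  have h5 : (sampleLaw Q n).real {ω | ε ≤ |T ω - r P|} ^ 2 ≤ 1 / 4 * (9 / 4) :=
    h3.trans (mul_le_mul h1.le hn (pow_nonneg (Finset.sum_nonneg fun a _ =>
      div_nonneg (sq_nonneg _) (hP a).le) n) (by norm_num))
  nlinarith

/-! ### Two-point laws -/

/-- The law on `Bool` with mass `p` at `true` and mass `1 - p` at `false`. -/
noncomputable def bernoulliLaw (p : ℝ) : Measure Bool :=
  ENNReal.ofReal (1 - p) • Measure.dirac false + ENNReal.ofReal p • Measure.dirac true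

/-- The random variable on `Bool` with values `B` at `true` and `-B` at `false`. -/
def signedValue (B : ℝ) (b : Bool) : ℝ := if b then B else -B

theorem abs_signedValue_le {B : ℝ} (hB : 0 ≤ B) (b : Bool) : |signedValue B b| ≤ B := by
  cases b <;> simp [signedValue, abs_of_nonneg hB]

theorem isProbabilityMeasure_bernoulliLaw {p : ℝ} (h0 : 0 ≤ p) (h1 : p ≤ 1) :
    IsProbabilityMeasure (bernoulliLaw p) := by
  refine ⟨?_⟩
  simp [bernoulliLaw, ← ENNReal.ofReal_add (sub_nonneg.2 h1) h0]

theorem lintegral_bernoulliLaw (p : ℝ) (f : Bool → ℝ≥0∞) :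
    ∫⁻ b, f b ∂bernoulliLaw p =
      ENNReal.ofReal (1 - p) * f false + ENNReal.ofReal p * f true := by
  simp [bernoulliLaw, lintegral_add_measure, lintegral_smul_measure, lintegral_dirac]

theorem integral_bernoulliLaw {p : ℝ} (h0 : 0 ≤ p) (h1 : p ≤ 1) (f : Bool → ℝ) :
    ∫ b, f b ∂bernoulliLaw p = (1 - p) * f false + p * f true := by
  rw [bernoulliLaw, integral_add_measure, integral_smul_measure, integral_smul_measure,
    integral_dirac, integral_dirac, ENNReal.toReal_ofReal (sub_nonneg.2 h1),
    ENNReal.toReal_ofReal h0, smul_eq_mul, smul_eq_mul]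
  · exact Integrable.of_finite.smul_measure ENNReal.ofReal_ne_top
  · exact Integrable.of_finite.smul_measure ENNReal.ofReal_ne_top

theorem bernoulliLaw_real_singleton {p : ℝ} (h0 : 0 ≤ p) (h1 : p ≤ 1) (b : Bool) :
    (bernoulliLaw p).real {b} = if b then p else 1 - p := by
  cases b <;> simp [bernoulliLaw, Measure.real, h0, h1]

theorem le_cam_bernoulliLaw {p p' : ℝ} (h0 : 0 < p) (h1 : p < 1) (h0' : 0 ≤ p') (h1' : p' ≤ 1)
    {n : ℕ} (hn : ((1 - p') ^ 2 / (1 - p) + p' ^ 2 / p) ^ n ≤ 9 / 4) (r : Measure Bool → ℝ)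
    {ε : ℝ} (hr : 2 * ε ≤ |r (bernoulliLaw p) - r (bernoulliLaw p')|) (T : (Fin n → Bool) → ℝ) :
    ∃ P : Measure Bool, IsProbabilityMeasure P ∧
      ENNReal.ofReal (1 / 4) ≤ sampleLaw P n {ω | ε ≤ |T ω - r P|} := by
  have := isProbabilityMeasure_bernoulliLaw h0.le h1.le
  have := isProbabilityMeasure_bernoulliLaw h0' h1'
  refine le_cam (bernoulliLaw p) (bernoulliLaw p') (fun b => ?_) ?_ r hr T
  · rw [bernoulliLaw_real_singleton h0.le h1.le]
    cases b <;> simp [h0, h1]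
  · rw [Fintype.sum_bool]
    simp only [bernoulliLaw_real_singleton h0.le h1.le, bernoulliLaw_real_singleton h0' h1']
    simpa [add_comm] using hn

/-- The law with full support serves as reference, so the χ² factor is (1-p)^(-n), at most 2 by
Bernoulli's inequality. -/
theorem le_cam_bernoulliLaw_zero {p : ℝ} (h0 : 0 < p) (h1 : p < 1)
    {n : ℕ} (hn : n * p ≤ 1 / 2) (r : Measure Bool → ℝ)
    {ε : ℝ} (hr : 2 * ε ≤ r (bernoulliLaw p) - r (bernoulliLaw 0)) (T : (Fin n → Bool) → ℝ) :
    ∃ P : Measure Bool, IsProbabilityMeasure P ∧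
      ENNReal.ofReal (1 / 4) ≤ sampleLaw P n {ω | ε ≤ |T ω - r P|} := by
  refine le_cam_bernoulliLaw h0 h1 le_rfl zero_le_one ?_ r (hr.trans (le_abs_self _)) T
  have h2 := one_add_mul_le_pow (a := -p) (by linarith) n
  have h3 : 1 / 2 ≤ (1 - p) ^ n := by
    rw [sub_eq_add_neg]; linarith
  have h4 : ((1 - (0 : ℝ)) ^ 2 / (1 - p) + 0 ^ 2 / p) ^ n = 1 / (1 - p) ^ n := by
    simp
  rw [h4, div_le_iff₀ (by linarith)]
  linarith

theorem robustValue_bernoulliLaw_zero_le {k τ B : ℝ} :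
    robustValue (cressieRead k) τ (bernoulliLaw 0) (signedValue B) ≤ -B := by
  have := isProbabilityMeasure_bernoulliLaw le_rfl zero_le_one
  refine csSup_le ⟨_, _, one_mem_ambiguitySet, rfl⟩ ?_
  rintro _ ⟨ζ, hζ, rfl⟩
  have h := (isDensity_iff.1 hζ.1).2.2.2
  rw [integral_bernoulliLaw le_rfl zero_le_one] at h
  simp only [integral_bernoulliLaw le_rfl zero_le_one]
  have hζ1 : ζ false = 1 := by linarith
  simp [hζ1, signedValue]

/-- The test density moves the mass of `true` from p to m. -/
theorem le_robustValue_bernoulliLaw {k τ B p m : ℝ} (hB : 0 ≤ B) (hp : 0 < p)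
    (hp1 : p < 1) (hm : 0 < m) (hm1 : m < 1)
    (hcost : (1 - p) * ((((1 - m) / (1 - p)) ^ k - k * ((1 - m) / (1 - p)) + k - 1) / (k * (k - 1)))
      + p * (((m / p) ^ k - k * (m / p) + k - 1) / (k * (k - 1))) ≤ τ) :
    -B + 2 * B * m ≤ robustValue (cressieRead k) τ (bernoulliLaw p) (signedValue B) := by
  have := isProbabilityMeasure_bernoulliLaw hp.le hp1.le
  have hp1' : 0 < 1 - p := sub_pos.2 hp1
  have hz0 : 0 < (1 - m) / (1 - p) := div_pos (sub_pos.2 hm1) hp1'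
  have hz1 : 0 < m / p := div_pos hm hp
  have hmem : (fun b : Bool => if b then m / p else (1 - m) / (1 - p)) ∈
      ambiguitySet (cressieRead k) τ (bernoulliLaw p) := by
    refine ⟨isDensity_iff.2 ⟨measurable_of_finite _, fun b => ?_, Integrable.of_finite, ?_⟩, ?_⟩
    · cases b
      · simpa using hz0.le
      · simpa using hz1.le
    · rw [integral_bernoulliLaw hp.le hp1.le]
      simp only [Bool.false_eq_true, if_false, if_true]
      field_simp
      ring
    · rw [lintegral_bernoulliLaw]
      simp only [Bool.false_eq_true, if_false, if_true]
      have f0 := cressieRead_formula_nonneg (k := k) hz0.le (Or.inl hz0.ne')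
      have f1 := cressieRead_formula_nonneg (k := k) hz1.le (Or.inl hz1.ne')
      rw [cressieRead_of_nonneg hz0.le (Or.inl hz0.ne'),
        cressieRead_of_nonneg hz1.le (Or.inl hz1.ne'), ← ENNReal.ofReal_mul hp1'.le,
        ← ENNReal.ofReal_mul hp.le, ← ENNReal.ofReal_add (mul_nonneg hp1'.le f0)
        (mul_nonneg hp.le f1)]
      exact ENNReal.ofReal_le_ofReal hcost
  refine le_of_eq_of_le ?_ (integral_le_robustValue (measurable_of_finite _)
    (abs_signedValue_le hB) hmem)
  rw [integral_bernoulliLaw hp.le hp1.le]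
  simp only [signedValue, Bool.false_eq_true, if_false, if_true]
  field_simp
  ring

/-! ### No uniform estimator for k < 1 -/

/-- The bound on the transport cost is free of p, continuous in m near 0, and zero at m = 0. -/
theorem exists_mass_of_cost_le {k τ : ℝ} (hτ : 0 < τ) :
    ∃ m, 0 < m ∧ m < 1 ∧ m / (1 - k) + (1 - (1 - m) ^ k) / (k * (1 - k)) ≤ τ := by
  have hcont : ContinuousAt (fun m : ℝ => m / (1 - k) + (1 - (1 - m) ^ k) / (k * (1 - k))) 0 := by
    refine (continuousAt_id.div_const _).add ((continuousAt_const.sub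
      (ContinuousAt.rpow_const (continuousAt_const.sub continuousAt_id) (Or.inl ?_))).div_const _)
    simp
  have hev := hcont.eventually_lt (continuousAt_const (y := τ)) (by simpa using hτ)
  have h := (hev.filter_mono nhdsWithin_le_nhds).and
    (Ioo_mem_nhdsGT (show (0 : ℝ) < 1 by norm_num))
  obtain ⟨m, hm, hm'⟩ := h.exists
  exact ⟨m, hm'.1, hm'.2, hm.le⟩

/-- For k < 1, φ_k(x) ≤ x/(1-k) when x ≥ 1, so the rare atom costs at most m/(1-k) however small p
is. -/
theorem bernoulli_cost_le_of_lt_one {k p m : ℝ} (hk : k < 1) (hk0 : k ≠ 0) (hp : 0 < p)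
    (hpm : p ≤ m) (hm1 : m < 1) :
    (1 - p) * ((((1 - m) / (1 - p)) ^ k - k * ((1 - m) / (1 - p)) + k - 1) / (k * (k - 1)))
      + p * (((m / p) ^ k - k * (m / p) + k - 1) / (k * (k - 1))) ≤
      m / (1 - k) + (1 - (1 - m) ^ k) / (k * (1 - k)) := by
  have hk' : 0 < 1 - k := sub_pos.2 hk
  have hform : ∀ x : ℝ, (x ^ k - k * x + k - 1) / (k * (k - 1)) =
      ((1 - x ^ k) / k + (x - 1)) / (1 - k) := fun x => by
    have : k - 1 ≠ 0 := by linarith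
    field_simp
    ring
  -- Dividing by k makes (1 - x^k)/k antitone for either sign of k, so both cases share the argument
  -- below.
  have hmono : ∀ x y : ℝ, 0 < x → x ≤ y → (1 - y ^ k) / k ≤ (1 - x ^ k) / k := fun x y hx hxy => by
    rcases lt_or_gt_of_ne hk0 with h | h
    · rw [div_le_div_right_of_neg h]
      linarith [Real.rpow_le_rpow_of_nonpos hx hxy h.le]
    · rw [div_le_div_iff_of_pos_right h]
      linarith [Real.rpow_le_rpow hx.le hxy h.le]
  have hp1 : 0 < 1 - p := by linarith
  have hm1' : 0 < 1 - m := by linarith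
  have hy : 1 - m ≤ (1 - m) / (1 - p) := by
    rw [le_div_iff₀ hp1]; nlinarith
  have hy1 : (1 - m) / (1 - p) ≤ 1 := by rw [div_le_one hp1]; linarith
  have hx : 1 ≤ m / p := by rw [le_div_iff₀ hp]; linarith
  have g1 := hmono _ _ hm1' hy
  have g2 := hmono _ _ one_pos hx
  rw [Real.one_rpow, sub_self, zero_div] at g2
  have g0 : 0 ≤ (1 - (1 - m) ^ k) / k := by
    have := hmono _ _ hm1' (show 1 - m ≤ 1 by linarith)
    rwa [Real.one_rpow, sub_self, zero_div] at this
  rw [hform, hform, mul_div_assoc', mul_div_assoc', ← add_div, ← div_div, ← add_div,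
    div_le_div_iff_of_pos_right hk']
  have t1 : (1 - p) * ((1 - ((1 - m) / (1 - p)) ^ k) / k + ((1 - m) / (1 - p) - 1)) ≤
      (1 - (1 - m) ^ k) / k := by
    calc _ ≤ (1 - p) * ((1 - (1 - m) ^ k) / k) :=
          mul_le_mul_of_nonneg_left (by linarith) hp1.le
      _ ≤ _ := mul_le_of_le_one_left g0 (by linarith)
  have t2 : p * ((1 - (m / p) ^ k) / k + (m / p - 1)) ≤ m := by
    calc _ ≤ p * (m / p) := mul_le_mul_of_nonneg_left (by linarith) hp.le
      _ = m := mul_div_cancel₀ _ hp.ne'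
  linarith

theorem no_uniform_estimator_of_lt_one {k τ B : ℝ} (hk : k < 1) (hk0 : k ≠ 0) (hτ : 0 < τ)
    (hB : 0 < B) :
    ∃ ε₀ : ℝ, 0 < ε₀ ∧ ∃ X : Bool → ℝ, (∀ ω, |X ω| ≤ B) ∧
      ∀ ε : ℝ, 0 < ε → ε ≤ ε₀ →
      ∀ n : ℕ, ∀ T : (Fin n → Bool) → ℝ, Measurable T →
      ∃ P : Measure Bool, IsProbabilityMeasure P ∧
        ENNReal.ofReal (1 / 4) ≤
          sampleLaw P n {ω | ε ≤ |T ω - robustValue (cressieRead k) τ P X|} := by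
  obtain ⟨m, hm, hm1, hcost⟩ := exists_mass_of_cost_le (k := k) hτ
  refine ⟨B * m, by positivity, signedValue B, abs_signedValue_le hB.le, ?_⟩
  intro ε hε hεm n T _
  have hn : (0 : ℝ) < n + 1 := by positivity
  -- An atom too rare for n samples; n + 1 keeps the denominator nonzero when n = 0.
  set p := min m (1 / (2 * (n + 1))) with hp
  have hp0 : 0 < p := lt_min hm (by positivity)
  have hpm : p ≤ m := min_le_left _ _
  refine le_cam_bernoulliLaw_zero hp0 (by linarith) ?_
    (fun P => robustValue (cressieRead k) τ P (signedValue B)) ?_ T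
  · calc n * p ≤ (n + 1) * (1 / (2 * (n + 1))) :=
          mul_le_mul (by linarith) (min_le_right _ _) hp0.le hn.le
      _ = 1 / 2 := by field_simp
  · have h1 := le_robustValue_bernoulliLaw hB.le hp0 (by linarith) hm hm1
      ((bernoulli_cost_le_of_lt_one hk hk0 hp0 hpm hm1).trans hcost)
    have h2 := robustValue_bernoulliLaw_zero_le (k := k) (τ := τ) (B := B)
    linarith

/-! ### Lower bound with the conjugate exponent -/

/-- Apart from p(m/p)^k, the terms of k(k-1) times the cost sum to at most (1-m) - k + (k-1) = -m ≤
0. -/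
theorem bernoulli_cost_le_of_one_lt {k τ p m : ℝ} (hk : 1 < k) (hp : 0 < p) (hpm : p ≤ m)
    (hm1 : m < 1) (hcost : p * (m / p) ^ k ≤ k * (k - 1) * τ) :
    (1 - p) * ((((1 - m) / (1 - p)) ^ k - k * ((1 - m) / (1 - p)) + k - 1) / (k * (k - 1)))
      + p * (((m / p) ^ k - k * (m / p) + k - 1) / (k * (k - 1))) ≤ τ := by
  have hκ : 0 < k * (k - 1) := mul_pos (by linarith) (by linarith)
  have hp1 : 0 < 1 - p := by linarith
  have hy0 : 0 ≤ (1 - m) / (1 - p) := div_nonneg (by linarith) hp1.le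
  have hy1 : (1 - m) / (1 - p) ≤ 1 := by rw [div_le_one hp1]; linarith
  have h1 : ((1 - m) / (1 - p)) ^ k ≤ (1 - m) / (1 - p) := by
    have := Real.rpow_le_rpow_of_exponent_ge_of_imp hy0 hy1 hk.le (fun _ h => by linarith)
    rwa [Real.rpow_one] at this
  have h2 : (1 - p) * ((1 - m) / (1 - p)) = 1 - m := mul_div_cancel₀ _ hp1.ne'
  have h3 : p * (m / p) = m := mul_div_cancel₀ _ hp.ne'
  have h4 := mul_le_mul_of_nonneg_left h1 hp1.le
  generalize m / p = x at *
  generalize (1 - m) / (1 - p) = y at *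
  rw [← mul_div_assoc, ← mul_div_assoc, ← add_div, div_le_iff₀ hκ]
  have e : (1 - p) * (y ^ k - k * y + k - 1) + p * (x ^ k - k * x + k - 1) =
      (1 - p) * y ^ k + p * x ^ k - k * ((1 - p) * y) - k * (p * x) + (k - 1) := by ring
  rw [e, h3, h2]
  rw [h2] at h4
  nlinarith

theorem lower_bound_conjugate_exponent {k τ B : ℝ} (hk : 1 < k) (hτ : 0 < τ) (hB : 0 < B) :
    ∃ c : ℝ, 0 < c ∧ ∃ ε₀ : ℝ, 0 < ε₀ ∧ ∀ ε : ℝ, 0 < ε → ε < ε₀ →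
      ∀ n : ℕ, (n : ℝ) ≤ c * ε ^ (-(k / (k - 1))) → ∀ T : (Fin n → Bool) → ℝ,
      ∃ P : Measure Bool, IsProbabilityMeasure P ∧ ENNReal.ofReal (1 / 4) ≤
        sampleLaw P n {ω | ε ≤ |T ω - robustValue (cressieRead k) τ P (signedValue B)|} := by
  have hkq : k.HolderConjugate (k / (k - 1)) := Real.HolderConjugate.conjExponent hk
  set q := k / (k - 1) with hq
  have hq1 := hkq.symm.lt
  have hκ : 0 < k * (k - 1) * τ := mul_pos (mul_pos (by linarith) (by linarith)) hτ
  obtain ⟨a, ha, ha1, hak⟩ : ∃ a : ℝ, 0 < a ∧ a ≤ 1 ∧ a ^ k ≤ k * (k - 1) * τ := by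
    refine ⟨min 1 ((k * (k - 1) * τ) ^ (1 / k)), lt_min one_pos (Real.rpow_pos_of_pos hκ _),
      min_le_left _ _, ?_⟩
    calc _ ≤ ((k * (k - 1) * τ) ^ (1 / k)) ^ k :=
          Real.rpow_le_rpow (le_min zero_le_one (Real.rpow_nonneg hκ.le _)) (min_le_right _ _)
            hkq.nonneg
      _ = _ := by rw [← Real.rpow_mul hκ.le, one_div_mul_cancel hkq.ne_zero, Real.rpow_one]
  -- The first constant yields np ≤ 1/2 for p = (ε/(aB))^q; the threshold on ε ensures p ≤ m < 1.
  refine ⟨(a * B) ^ q / 2, by positivity, B * a ^ k, by positivity, ?_⟩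
  intro ε hε hεa n hn T
  set m := ε / B with hm
  have hm0 : 0 < m := div_pos hε hB
  have hma : m < a ^ k := by rw [hm, div_lt_iff₀ hB]; linarith
  have hm1 : m < 1 := hma.trans_le (Real.rpow_le_one ha.le ha1 hkq.nonneg)
  -- The solution of p(m/p)^k = a^k, the smallest atom that can be raised to mass m within this
  -- budget.
  set p := (m / a) ^ q with hp
  have hma0 : 0 < m / a := div_pos hm0 ha
  have hp0 : 0 < p := Real.rpow_pos_of_pos hma0 _
  have hexp : (k - 1) * (q - 1) = 1 := by
    have := hkq.sub_one_mul_conj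
    nlinarith
  have hpm : p ≤ m := by
    have h1 : m / a ≤ a ^ (k - 1) := by
      rw [Real.rpow_sub_one ha.ne']
      exact div_le_div_of_nonneg_right hma.le ha.le
    have h2 : (m / a) ^ (q - 1) ≤ a := by
      have := Real.rpow_le_rpow hma0.le h1 (show 0 ≤ q - 1 by linarith)
      rwa [← Real.rpow_mul ha.le, hexp, Real.rpow_one] at this
    calc p = (m / a) ^ (q - 1) * (m / a) := by
          rw [← Real.rpow_add_one hma0.ne', sub_add_cancel]
      _ ≤ a * (m / a) := mul_le_mul_of_nonneg_right h2 hma0.le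
      _ = m := mul_div_cancel₀ _ ha.ne'
  have hcost : p * (m / p) ^ k ≤ k * (k - 1) * τ := by
    refine le_of_eq_of_le ?_ hak
    have h1 : p ^ k = (m / a) ^ k * p := by
      rw [hp, ← Real.rpow_mul hma0.le, ← Real.rpow_add hma0]
      congr 1
      have := hkq.sub_one_mul_conj
      linarith
    rw [Real.div_rpow hm0.le hp0.le, h1, Real.div_rpow hm0.le ha.le]
    have := Real.rpow_pos_of_pos hm0 k
    have := Real.rpow_pos_of_pos ha k
    field_simp
  refine le_cam_bernoulliLaw_zero hp0 (by linarith) ?_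
    (fun P => robustValue (cressieRead k) τ P (signedValue B)) ?_ T
  · have h1 : p = ε ^ q / (a * B) ^ q := by
      rw [hp, hm, div_div, mul_comm B a, Real.div_rpow hε.le (by positivity)]
    calc n * p ≤ (a * B) ^ q / 2 * ε ^ (-q) * p := mul_le_mul_of_nonneg_right hn hp0.le
      _ = 1 / 2 := by
        rw [h1, Real.rpow_neg hε.le]
        field_simp
  · have h1 := le_robustValue_bernoulliLaw hB.le hp0 (by linarith) hm0 hm1
      (bernoulli_cost_le_of_one_lt hk hp0 hpm hm1 hcost)
    have h2 := robustValue_bernoulliLaw_zero_le (k := k) (τ := τ) (B := B)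
    have h3 : B * m = ε := mul_div_cancel₀ _ hB.ne'
    linarith

/-! ### Lower bound with exponent two -/

theorem dualValue_bernoulliLaw {A q B p : ℝ} (h0 : 0 ≤ p) (h1 : p ≤ 1) (t : ℝ) :
    dualValue A q (bernoulliLaw p) (signedValue B) t =
      t + A * ((1 - p) * max (-B - t) 0 ^ q + p * max (B - t) 0 ^ q) ^ (1 / q) := by
  rw [dualValue, hingeMoment, integral_bernoulliLaw h0 h1]
  simp [signedValue]

/-- The new law mixes the old one with the point mass at `true`. The dual value is concave in the
law because x^(1/q) is, and at that point mass it is at least B since A ≥ 1. -/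
theorem dualValue_bernoulliLaw_mix {A q B p s : ℝ} (hA : 1 ≤ A) (hq : 1 ≤ q) (h0 : 0 ≤ p)
    (h1 : p ≤ 1) (hs0 : 0 ≤ s) (hs1 : s ≤ 1) (t : ℝ) :
    (1 - s) * dualValue A q (bernoulliLaw p) (signedValue B) t + s * B ≤
      dualValue A q (bernoulliLaw (p + s * (1 - p))) (signedValue B) t := by
  have hq' : 0 ≤ 1 / q := by positivity
  rw [dualValue_bernoulliLaw h0 h1, dualValue_bernoulliLaw
    (add_nonneg h0 (mul_nonneg hs0 (sub_nonneg.2 h1))) (by nlinarith)]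
  have hu : 0 ≤ max (-B - t) 0 ^ q := Real.rpow_nonneg (le_max_right _ _) _
  have hv : 0 ≤ max (B - t) 0 ^ q := Real.rpow_nonneg (le_max_right _ _) _
  have hv' : (max (B - t) 0 ^ q) ^ (1 / q) = max (B - t) 0 := by
    rw [← Real.rpow_mul (le_max_right _ _), mul_one_div_cancel (by linarith), Real.rpow_one]
  set u := max (-B - t) 0 ^ q
  set v := max (B - t) 0 ^ q
  have hw : 0 ≤ (1 - p) * u + p * v :=
    add_nonneg (mul_nonneg (sub_nonneg.2 h1) hu) (mul_nonneg h0 hv)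
  have hc := (Real.concaveOn_rpow hq' ((div_le_one (by linarith)).2 hq)).2 hw hv
    (sub_nonneg.2 hs1) hs0 (sub_add_cancel 1 s)
  simp only [smul_eq_mul, hv'] at hc
  have he : (1 - s) * ((1 - p) * u + p * v) + s * v =
      (1 - (p + s * (1 - p))) * u + (p + s * (1 - p)) * v := by ring
  rw [he] at hc
  have hmax : B - t ≤ A * max (B - t) 0 :=
    (le_max_left _ _).trans (le_mul_of_one_le_left (le_max_right _ _) hA)
  have h2 := mul_le_mul_of_nonneg_left hc (zero_le_one.trans hA)
  have h3 := mul_le_mul_of_nonneg_left hmax hs0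
  nlinarith

theorem robustValue_bernoulliLaw_mix {k q τ B p s : ℝ} (hkq : k.HolderConjugate q) (hτ : 0 < τ)
    (hB : 0 < B) (h0 : 0 ≤ p) (h1 : p ≤ 1) (hs0 : 0 ≤ s) (hs1 : s ≤ 1) :
    (1 - s) * robustValue (cressieRead k) τ (bernoulliLaw p) (signedValue B) + s * B ≤
      robustValue (cressieRead k) τ (bernoulliLaw (p + s * (1 - p))) (signedValue B) := by
  have := isProbabilityMeasure_bernoulliLaw h0 h1
  have := isProbabilityMeasure_bernoulliLaw (p := p + s * (1 - p))
    (add_nonneg h0 (mul_nonneg hs0 (sub_nonneg.2 h1))) (by nlinarith)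
  obtain ⟨L, hBL, hL⟩ := exists_dual_range hkq.lt hτ hB
  obtain ⟨t, -, ht⟩ := exists_dualValue_le_robustValue (P := bernoulliLaw (p + s * (1 - p))) hkq hτ
    (measurable_of_finite (signedValue B)) (abs_signedValue_le hB.le) hB.le hBL hL
  refine le_trans ?_ ((dualValue_bernoulliLaw_mix (one_lt_moment_radius hkq.lt hτ).le
    hkq.symm.lt.le h0 h1 hs0 hs1 t).trans ht)
  have h2 := robustValue_le_dualValue (P := bernoulliLaw p) hkq hτ
    (measurable_of_finite (signedValue B)) (abs_signedValue_le hB.le) t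
  have h3 := mul_le_mul_of_nonneg_left h2 (sub_nonneg.2 hs1)
  linarith

theorem exists_robustValue_bernoulliLaw_nonpos {k q τ B : ℝ} (hkq : k.HolderConjugate q)
    (hτ : 0 < τ) (hB : 0 < B) : ∃ p : ℝ, 0 < p ∧ p < 1 ∧
      robustValue (cressieRead k) τ (bernoulliLaw p) (signedValue B) ≤ 0 := by
  have hA := one_lt_moment_radius hkq.lt hτ
  have hq := hkq.symm.lt
  set A := (1 + k * (k - 1) * τ) ^ (1 / k) with hAdef
  have hA2 : 0 < (2 * A)⁻¹ := by positivity
  have hA2' : (2 * A)⁻¹ < 1 := inv_lt_one_of_one_lt₀ (by linarith)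
  -- Makes the dual value at t = -B, namely -B + 2AB p^(1/q), equal to zero.
  set p := (2 * A)⁻¹ ^ q with hp
  have hp0 : 0 < p := Real.rpow_pos_of_pos hA2 _
  have hp1 : p < 1 := Real.rpow_lt_one hA2.le hA2' (by linarith)
  have := isProbabilityMeasure_bernoulliLaw hp0.le hp1.le
  refine ⟨p, hp0, hp1, ?_⟩
  have h := robustValue_le_dualValue (P := bernoulliLaw p) hkq hτ
    (measurable_of_finite (signedValue B)) (abs_signedValue_le hB.le) (-B)
  refine h.trans (le_of_eq ?_)
  rw [dualValue_bernoulliLaw hp0.le hp1.le, sub_self, max_self, Real.zero_rpow (by linarith),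
    mul_zero, zero_add, max_eq_left (by linarith), hp, ← Real.mul_rpow hA2.le (by linarith),
    ← Real.rpow_mul (mul_nonneg hA2.le (by linarith)), mul_one_div_cancel (by linarith),
    Real.rpow_one]
  field_simp
  ring

theorem lower_bound_exponent_two {k τ B : ℝ} (hk : 1 < k) (hτ : 0 < τ) (hB : 0 < B) :
    ∃ c : ℝ, 0 < c ∧ ∃ ε₀ : ℝ, 0 < ε₀ ∧ ∀ ε : ℝ, 0 < ε → ε < ε₀ →
      ∀ n : ℕ, (n : ℝ) ≤ c * ε ^ (-2 : ℝ) → ∀ T : (Fin n → Bool) → ℝ,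
      ∃ P : Measure Bool, IsProbabilityMeasure P ∧ ENNReal.ofReal (1 / 4) ≤
        sampleLaw P n {ω | ε ≤ |T ω - robustValue (cressieRead k) τ P (signedValue B)|} := by
  have hkq : k.HolderConjugate (k / (k - 1)) := Real.HolderConjugate.conjExponent hk
  obtain ⟨p, hp0, hp1, hR⟩ := exists_robustValue_bernoulliLaw_nonpos hkq hτ hB
  refine ⟨B ^ 2 * p / 8, by positivity, B / 2, by positivity, ?_⟩
  intro ε hε hεB n hn T
  -- As R ≤ 0 at p, mixing in weight s raises R by at least s(B - R) ≥ sB = 2ε, while χ² grows only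
  -- like s². The constant B²p/8 gives n s²/p ≤ 1/2, and exp(1/2) ≤ 9/4.
  set s := 2 * ε / B with hs
  have hs0 : 0 < s := by positivity
  have hs1 : s ≤ 1 := by rw [hs, div_le_one hB]; linarith
  have hp1' : 0 < 1 - p := sub_pos.2 hp1
  refine le_cam_bernoulliLaw hp0 hp1 (p' := p + s * (1 - p)) (by positivity) (by nlinarith) ?_
    (fun P => robustValue (cressieRead k) τ P (signedValue B)) ?_ T
  · have h1 : (1 - (p + s * (1 - p))) ^ 2 / (1 - p) + (p + s * (1 - p)) ^ 2 / p =
        s ^ 2 * (1 - p) / p + 1 := by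
      field_simp
      ring
    have h2 : s ^ 2 * (1 - p) / p ≤ s ^ 2 / p :=
      div_le_div_of_nonneg_right (mul_le_of_le_one_right (sq_nonneg s) (by linarith)) hp0.le
    have h3 : n * (s ^ 2 / p) ≤ 1 / 2 := by
      calc n * (s ^ 2 / p) ≤ B ^ 2 * p / 8 * ε ^ (-2 : ℝ) * (s ^ 2 / p) :=
            mul_le_mul_of_nonneg_right hn (by positivity)
        _ = 1 / 2 := by
          rw [Real.rpow_neg hε.le, Real.rpow_two, hs]
          field_simp
          norm_num
    have h4 : 0 ≤ s ^ 2 * (1 - p) / p := by positivity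
    rw [h1]
    calc (s ^ 2 * (1 - p) / p + 1) ^ n ≤ Real.exp (s ^ 2 / p) ^ n :=
          pow_le_pow_left₀ (by linarith)
            ((Real.add_one_le_exp _).trans (Real.exp_le_exp.2 h2)) n
      _ = Real.exp (n * (s ^ 2 / p)) := (Real.exp_nat_mul _ n).symm
      _ ≤ Real.exp (1 / 2) := Real.exp_le_exp.2 h3
      _ ≤ 9 / 4 := by
        have h5 : Real.exp (1 / 2) ^ 2 = Real.exp 1 := by
          rw [← Real.exp_nat_mul]; norm_num
        have h6 := Real.exp_one_lt_d9
        nlinarith [Real.exp_pos (1 / 2)]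
  · have h1 := robustValue_bernoulliLaw_mix hkq hτ hB hp0.le hp1.le hs0.le hs1
    have h2 : s * B = 2 * ε := div_mul_cancel₀ _ hB.ne'
    have h3 := mul_nonneg hs0.le (neg_nonneg.2 hR)
    rw [abs_sub_comm]
    refine le_trans ?_ (le_abs_self _)
    linarith

theorem lower_bound_max_exponent {k τ B : ℝ} (hk : 1 < k) (hτ : 0 < τ) (hB : 0 < B) :
    ∃ c : ℝ, 0 < c ∧ ∃ ε₀ : ℝ, 0 < ε₀ ∧
      ∃ X : Bool → ℝ, (∀ ω, |X ω| ≤ B) ∧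
      ∀ ε : ℝ, 0 < ε → ε < ε₀ →
      ∀ n : ℕ, (n : ℝ) ≤ c * ε ^ (-(max 2 (k / (k - 1)))) →
      ∀ T : (Fin n → Bool) → ℝ, Measurable T →
      ∃ P : Measure Bool, IsProbabilityMeasure P ∧
        ENNReal.ofReal (1 / 4) ≤
          sampleLaw P n {ω | ε ≤ |T ω - robustValue (cressieRead k) τ P X|} := by
  rcases le_total 2 (k / (k - 1)) with h | h
  · obtain ⟨c, hc, ε₀, hε₀, H⟩ := lower_bound_conjugate_exponent hk hτ hB
    rw [max_eq_right h]
    exact ⟨c, hc, ε₀, hε₀, signedValue B, abs_signedValue_le hB.le,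
      fun ε h1 h2 n hn T _ => H ε h1 h2 n hn T⟩
  · obtain ⟨c, hc, ε₀, hε₀, H⟩ := lower_bound_exponent_two hk hτ hB
    rw [max_eq_left h]
    exact ⟨c, hc, ε₀, hε₀, signedValue B, abs_signedValue_le hB.le,
      fun ε h1 h2 n hn T _ => H ε h1 h2 n hn T⟩

theorem mainTheorem9 (k τ B : ℝ) (hk0 : k ≠ 0) (hk1 : k ≠ 1) (hτ : 0 < τ) (hB : 0 < B) :
    (1 < k →
      -- upper bound for the sample average approximation
      (∃ C : ℝ, 0 < C ∧ ∃ m : ℕ,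
        ∀ (Ω : Type*) [MeasurableSpace Ω] (P : Measure Ω) [IsProbabilityMeasure P]
          (X : Ω → ℝ), Measurable X → (∀ ω, |X ω| ≤ B) →
        ∀ ε δ : ℝ, 0 < ε → ε ≤ B → 0 < δ → δ < 1 →
        ∀ n : ℕ,
          C * ε ^ (-(max 2 (k / (k - 1)))) * (1 + Real.log (B / ε)) ^ m
              * (1 + Real.log (1 / δ)) ≤ (n : ℝ) →
          ENNReal.ofReal (1 - δ) ≤
            sampleLaw P n {ω | |robustValue (cressieRead k) τ P X
              - saaValue (cressieRead k) τ X ω| ≤ ε}) ∧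
      -- matching lower bound for every estimator
      (∃ c : ℝ, 0 < c ∧ ∃ ε₀ : ℝ, 0 < ε₀ ∧
        ∃ X : Bool → ℝ, (∀ ω, |X ω| ≤ B) ∧
        ∀ ε : ℝ, 0 < ε → ε < ε₀ →
        ∀ n : ℕ, (n : ℝ) ≤ c * ε ^ (-(max 2 (k / (k - 1)))) →
        ∀ T : (Fin n → Bool) → ℝ, Measurable T →
        ∃ P : Measure Bool, IsProbabilityMeasure P ∧
          ENNReal.ofReal (1 / 4) ≤
            sampleLaw P n {ω | ε ≤ |T ω - robustValue (cressieRead k) τ P X|})) ∧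
    (k < 1 →
      ∃ ε₀ : ℝ, 0 < ε₀ ∧ ∃ X : Bool → ℝ, (∀ ω, |X ω| ≤ B) ∧
        ∀ ε : ℝ, 0 < ε → ε ≤ ε₀ →
        ∀ n : ℕ, ∀ T : (Fin n → Bool) → ℝ, Measurable T →
        ∃ P : Measure Bool, IsProbabilityMeasure P ∧
          ENNReal.ofReal (1 / 4) ≤
            sampleLaw P n {ω | ε ≤ |T ω - robustValue (cressieRead k) τ P X|}) := by
  exact ⟨fun hk => ⟨saa_upper_bound hk hτ hB, lower_bound_max_exponent hk hτ hB⟩,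
    fun hk => no_uniform_estimator_of_lt_one hk hk0 hτ hB⟩
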